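/- A bipartite graph $\Gamma=(V_1,E,V_2)$ is a finite graph with an ordered pair of vertex sets $V_1,V_2$ in which every edge $e\in E$ joins a vertex $V_1(e)\in V_1$ with a vertex $V_2(e)\in V_2$; multiple edges are allowed and every vertex is an end of some edge. Isomorphisms preserve the order of $(V_1,V_2)$ and consist of bijections of $V_1$, $E$ and $V_2$; $\operatorname{Aut}(\Gamma)$ is the group of automorphisms. The degree is $|\Gamma|=|E|$. A graph is simple if each of its connected components has exactly two vertices. Let $B_n$ be the complex vector space with basis the isomorphism classes of bipartite graphs of degree $n$. Product on $B_n$. For graphs $\Gamma=(V_1,E,V_2)$ and $\Gamma'=(V_1',E',V_2')$ of degree $n$ consider the pairs $(\chi,F)$ of a valency-preserving map $\chi:V_2\to V_1'$ and a bijection $F:E\to E'$ with $\chi(V_2(e))=V_1'(F(e))$ for all $e\in E$. Let $(V_1,\overline F,V_2')$ be the graph whose edges are the pairs $(e,F(e))$, joining $V_1(e)$ with $V_2'(F(e))$, and let $\operatorname{Aut}_F$ be the group of those automorphisms of $(V_1,\overline F,V_2')$ that induce on $E$ an automorphism of $\Gamma$. Then $$[\Gamma]*[\Gamma']=\sum_{(\chi,F)}\frac{|\operatorname{Aut}(V_1,\overline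 F,V_2')|}{|\operatorname{Aut}_F(V_1,\overline F,V_2')|}\,[(V_1,\overline F,V_2')],$$ where the sum is over the pairs $(\chi,F)$ up to the action of $\operatorname{Aut}(\Gamma)\times\operatorname{Aut}(\Gamma')$; the product is extended bilinearly. For $m\le n$ let $\rho^B_n:B_m\to B_n$ be the linear map with $$\rho^B_n(\Gamma)=\sum_{S}\frac{|\operatorname{Aut}(\Gamma\sqcup S)|}{|\operatorname{Aut}(\Gamma)|\,|\operatorname{Aut}(S)|}\,[\Gamma\sqcup S],$$ the sum being over the isomorphism classes of simple graphs $S$ of degree $n-m$ (the empty graph if $n=m$). Let $B_\infty=\bigoplus_{n\ge1}B_n$ be the vector space generated by all bipartite graphs of positive degree. For graphs $\Gamma_1,\Gamma_2$ put $M=\max(|\Gamma_1|,|\Gamma_2|)$, and define recursively, for $n\ge M$, $$\{\Gamma_1\Gamma_2\}_n=\rho^B_n(\Gamma_1)*\rho^B_n(\Gamma_2)-\sum_{k=M}^{n-1}\rho^B_n(\{\Gamma_1\Gamma_2\}_k)\in B_n .$$ The product of $B_\infty$ is the bilinear extension of $\Gamma_1\circ\Gamma_2=\sum_{n\ge M}\{\Gamma_1\Gamma_2\}_n$.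 Let $B^{as}=\prod_{n\ge1}B_n$ with componentwise operations. **Theorem.** For graphs of positive degree, $\{\Gamma_1\Gamma_2\}_n=0$ whenever $n>|\Gamma_1|+|\Gamma_2|$, so that $\circ$ is well defined, and the algebras $(B_\infty,\circ)$ and $(B^{as},*)$ are associative. There is an injective homomorphism of complex algebras (not required to preserve units) $$\rho^B_\uparrow:B_\infty\to B^{as}$$ which sends each $b\in B_n$, $n\ge1$, to the sequence $(b^1,b^2,\dots)$ with $b^i=0$ for $i<n$ and $b^i=\rho^B_i(b)$ for $i\ge n$. -/

import Mathlib

noncomputable section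

/-- A finite bipartite graph `(V₁, E, V₂)`: an ordered pair of vertex sets and a set of edges, every
edge joining a vertex of `V₁` with a vertex of `V₂`.  Multiple edges are allowed, and every vertex is
an end of some edge. -/
structure BipartiteGraph : Type 1 where
  V₁ : Type
  E : Type
  V₂ : Type
  finE : Finite E
  left : E → V₁
  right : E → V₂
  left_surj : Function.Surjective left
  right_surj : Function.Surjective right

namespace BipartiteGraph

instance (Γ : BipartiteGraph) : Finite Γ.E := Γ.finE
instance (Γ : BipartiteGraph) : Finite Γ.V₁ := Finite.of_surjective _ Γ.left_surj
instance (Γ : BipartiteGraph) : Finite Γ.V₂ := Finite.of_surjective _ Γ.right_surj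

/-- The degree of a bipartite graph is its number of edges. -/
def degree (Γ : BipartiteGraph) : ℕ := Nat.card Γ.E

/-- Isomorphisms of bipartite graphs; they respect the order of the two vertex sets. -/
@[ext]
structure Iso (Γ Γ' : BipartiteGraph) where
  onV₁ : Γ.V₁ ≃ Γ'.V₁
  onE : Γ.E ≃ Γ'.E
  onV₂ : Γ.V₂ ≃ Γ'.V₂
  left_comm : ∀ e, Γ'.left (onE e) = onV₁ (Γ.left e)
  right_comm : ∀ e, Γ'.right (onE e) = onV₂ (Γ.right e)

/-- The automorphisms of a bipartite graph. -/
abbrev Aut (Γ : BipartiteGraph) : Type := Iso Γ Γ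

/-- The number of automorphisms of a bipartite graph. -/
def autCard (Γ : BipartiteGraph) : ℕ := Nat.card Γ.Aut

/-- Two bipartite graphs are isomorphic. -/
def IsIso (Γ Γ' : BipartiteGraph) : Prop := Nonempty (Iso Γ Γ')

theorem isIso_equivalence : Equivalence IsIso where
  refl Γ := ⟨⟨Equiv.refl _, Equiv.refl _, Equiv.refl _, fun _ => rfl, fun _ => rfl⟩⟩
  symm := by
    rintro Γ Γ' ⟨f⟩
    refine ⟨⟨f.onV₁.symm, f.onE.symm, f.onV₂.symm, fun e => ?_, fun e => ?_⟩⟩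
    · rw [Equiv.eq_symm_apply, ← f.left_comm, Equiv.apply_symm_apply]
    · rw [Equiv.eq_symm_apply, ← f.right_comm, Equiv.apply_symm_apply]
  trans := by
    rintro Γ Γ' Γ'' ⟨f⟩ ⟨g⟩
    exact ⟨⟨f.onV₁.trans g.onV₁, f.onE.trans g.onE, f.onV₂.trans g.onV₂,
      fun e => by simp [g.left_comm, f.left_comm],
      fun e => by simp [g.right_comm, f.right_comm]⟩⟩

/-- The graph on the set of all vertices, two vertices being adjacent when an edge joins them. -/
def toSimpleGraph (Γ : BipartiteGraph) : SimpleGraph (Γ.V₁ ⊕ Γ.V₂) :=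
  SimpleGraph.fromRel fun a b => ∃ e, a = Sum.inl (Γ.left e) ∧ b = Sum.inr (Γ.right e)

/-- A bipartite graph is simple when every connected component has exactly two vertices
(with any positive number of edges between them). -/
def IsSimple (Γ : BipartiteGraph) : Prop :=
  ∀ c : Γ.toSimpleGraph.ConnectedComponent, c.supp.ncard = 2

/-- The disjoint union of two bipartite graphs. -/
def disjUnion (Γ Γ' : BipartiteGraph) : BipartiteGraph where
  V₁ := Γ.V₁ ⊕ Γ'.V₁
  E := Γ.E ⊕ Γ'.E
  V₂ := Γ.V₂ ⊕ Γ'.V₂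
  finE := inferInstance
  left := Sum.map Γ.left Γ'.left
  right := Sum.map Γ.right Γ'.right
  left_surj := Γ.left_surj.sumMap Γ'.left_surj
  right_surj := Γ.right_surj.sumMap Γ'.right_surj

theorem degree_disjUnion (Γ Γ' : BipartiteGraph) :
    (disjUnion Γ Γ').degree = Γ.degree + Γ'.degree :=
  Nat.card_sum

/-- A pair `(χ, F)`, where `χ : V₂ → V₁'` preserves the valency of vertices and `F` is a bijection
of the edges (a subset of `E × E'` projecting bijectively to both factors) that is consistent
with `χ`. -/
@[ext]
structure Gluing (Γ Γ' : BipartiteGraph) where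
  χ : Γ.V₂ → Γ'.V₁
  valency : ∀ v, Nat.card {e' // Γ'.left e' = χ v} = Nat.card {e // Γ.right e = v}
  F : Γ.E ≃ Γ'.E
  consistent : ∀ e, χ (Γ.right e) = Γ'.left (F e)

instance (Γ Γ' : BipartiteGraph) : Finite (Gluing Γ Γ') :=
  Finite.of_injective (fun g => (g.χ, g.F)) fun g g' h => by
    simp only [Prod.mk.injEq] at h
    exact Gluing.ext h.1 h.2

namespace Gluing

variable {Γ Γ' : BipartiteGraph}

/-- The bipartite graph `(V₁, F̄, V₂')`: an edge is a pair `(e, e') ∈ F` glued together, labelled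
here by `e`. -/
def glued (g : Gluing Γ Γ') : BipartiteGraph where
  V₁ := Γ.V₁
  E := Γ.E
  V₂ := Γ'.V₂
  finE := inferInstance
  left := Γ.left
  right := fun e => Γ'.right (g.F e)
  left_surj := Γ.left_surj
  right_surj := Γ'.right_surj.comp g.F.surjective

/-- The number of those automorphisms of `(V₁, F̄, V₂')` that induce on the set `E` an automorphism
of the graph `(V₁, E, V₂)`. -/
def autFCard (g : Gluing Γ Γ') : ℕ :=
  Nat.card {σ : g.glued.Aut // ∃ τ : Γ.Aut, ∀ e : Γ.E, τ.onE e = σ.onE e}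

/-- Two gluings are equivalent when automorphisms of the two graphs carry one to the other. -/
def equiv (Γ Γ' : BipartiteGraph) : Setoid (Gluing Γ Γ') where
  r g h := ∃ (a : Γ.Aut) (a' : Γ'.Aut), ∀ e, h.F (a.onE e) = a'.onE (g.F e)
  iseqv :=
    { refl := fun _ => ⟨⟨Equiv.refl _, Equiv.refl _, Equiv.refl _, fun _ => rfl, fun _ => rfl⟩,
        ⟨Equiv.refl _, Equiv.refl _, Equiv.refl _, fun _ => rfl, fun _ => rfl⟩, fun _ => rfl⟩
      symm := by
        rintro g h ⟨a, a', H⟩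
        refine ⟨⟨a.onV₁.symm, a.onE.symm, a.onV₂.symm, fun e => ?_, fun e => ?_⟩,
          ⟨a'.onV₁.symm, a'.onE.symm, a'.onV₂.symm, fun e => ?_, fun e => ?_⟩, fun e => ?_⟩
        · rw [Equiv.eq_symm_apply, ← a.left_comm, Equiv.apply_symm_apply]
        · rw [Equiv.eq_symm_apply, ← a.right_comm, Equiv.apply_symm_apply]
        · rw [Equiv.eq_symm_apply, ← a'.left_comm, Equiv.apply_symm_apply]
        · rw [Equiv.eq_symm_apply, ← a'.right_comm, Equiv.apply_symm_apply]
        · rw [Equiv.eq_symm_apply, ← H, Equiv.apply_symm_apply]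
      trans := by
        rintro g h k ⟨a, a', H⟩ ⟨b, b', K⟩
        exact ⟨⟨a.onV₁.trans b.onV₁, a.onE.trans b.onE, a.onV₂.trans b.onV₂,
            fun e => by simp [a.left_comm, b.left_comm],
            fun e => by simp [a.right_comm, b.right_comm]⟩,
          ⟨a'.onV₁.trans b'.onV₁, a'.onE.trans b'.onE, a'.onV₂.trans b'.onV₂,
            fun e => by simp [a'.left_comm, b'.left_comm],
            fun e => by simp [a'.right_comm, b'.right_comm]⟩,
          fun e => by simp [H, K]⟩ }

end Gluing

/-- Isomorphism as an equivalence relation on the bipartite graphs of degree `n`. -/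
def isoSetoid (n : ℕ) : Setoid {Γ : BipartiteGraph // Γ.degree = n} where
  r Γ Γ' := IsIso Γ.1 Γ'.1
  iseqv :=
    { refl := fun Γ => isIso_equivalence.refl Γ.1
      symm := fun h => isIso_equivalence.symm h
      trans := fun h k => isIso_equivalence.trans h k }

/-- The set of isomorphism classes of bipartite graphs of degree `n`. -/
def Classes (n : ℕ) : Type 1 := Quotient (isoSetoid n)

namespace Classes

/-- The isomorphism class of a graph. -/
def mk {n : ℕ} (Γ : BipartiteGraph) (h : Γ.degree = n) : Classes n :=
  Quotient.mk (isoSetoid n) ⟨Γ, h⟩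

/-- A graph in a given isomorphism class. -/
def rep {n : ℕ} (x : Classes n) : BipartiteGraph := (Quotient.out x).1

theorem degree_rep {n : ℕ} (x : Classes n) : x.rep.degree = n := (Quotient.out x).2

theorem mk_rep {n : ℕ} (x : Classes n) : mk x.rep x.degree_rep = x := Quotient.out_eq x

theorem rep_mk {n : ℕ} (Γ : BipartiteGraph) (h : Γ.degree = n) : IsIso (mk Γ h).rep Γ :=
  Quotient.mk_out (s := isoSetoid n) ⟨Γ, h⟩

instance (n : ℕ) : Finite (Classes n) := by
  have hS : Finite (Setoid (Fin n)) :=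
    Finite.of_injective (fun s : Setoid (Fin n) => fun a b => s.r a b) fun s t h => by
      ext a b
      exact iff_of_eq (congrFun (congrFun h a) b)
  let f : Setoid (Fin n) × Setoid (Fin n) → Classes n := fun p =>
    mk { V₁ := Quotient p.1, E := Fin n, V₂ := Quotient p.2, finE := inferInstance,
         left := Quotient.mk _, right := Quotient.mk _,
         left_surj := Quotient.mk_surjective, right_surj := Quotient.mk_surjective }
      (Nat.card_fin n)
  refine Finite.of_surjective f fun x => ?_
  have hd := x.degree_rep
  let e : x.rep.E ≃ Fin n := Finite.equivFinOfCardEq hd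
  have hl : Function.Surjective (fun i => x.rep.left (e.symm i)) :=
    x.rep.left_surj.comp e.symm.surjective
  have hr : Function.Surjective (fun i => x.rep.right (e.symm i)) :=
    x.rep.right_surj.comp e.symm.surjective
  refine ⟨(Setoid.ker fun i => x.rep.left (e.symm i), Setoid.ker fun i => x.rep.right (e.symm i)), ?_⟩
  refine Eq.trans ?_ (mk_rep x)
  refine Quotient.sound (s := isoSetoid n) ⟨⟨Setoid.quotientKerEquivOfSurjective _ hl, e.symm,
    Setoid.quotientKerEquivOfSurjective _ hr, fun i => rfl, fun i => rfl⟩⟩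

instance (n : ℕ) : Fintype (Classes n) := Fintype.ofFinite _

end Classes

/-- The complex vector space `B_n` with basis the isomorphism classes of bipartite graphs of
degree `n`. -/
def B (n : ℕ) : Type 1 := Classes n →₀ ℂ

instance (n : ℕ) : AddCommGroup (B n) := inferInstanceAs (AddCommGroup (Classes n →₀ ℂ))
instance (n : ℕ) : Module ℂ (B n) := inferInstanceAs (Module ℂ (Classes n →₀ ℂ))

/-- The basis vector of `B_n` given by an isomorphism class. -/
def vec {n : ℕ} (x : Classes n) : B n := (Finsupp.single x 1 : Classes n →₀ ℂ)

/-- The linear map on `B_n` with prescribed values on the basis. -/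
def liftB {n : ℕ} {M : Type 1} [AddCommGroup M] [Module ℂ M] (f : Classes n → M) : B n →ₗ[ℂ] M :=
  (Finsupp.linearCombination ℂ f : (Classes n →₀ ℂ) →ₗ[ℂ] M)

open Classical in
instance (Γ Γ' : BipartiteGraph) : Fintype (Quotient (Gluing.equiv Γ Γ')) := Fintype.ofFinite _

/-- The product of two graphs in `B_n`: the sum over the gluings `(χ, F)`, up to equivalence, of
`(|Aut (V₁, F̄, V₂')| / |Aut_F (V₁, F̄, V₂')|) [(V₁, F̄, V₂')]`. The summand does not depend on the
choice of representatives. -/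
def mulVec {n : ℕ} (x y : Classes n) : B n :=
  ∑ q : Quotient (Gluing.equiv x.rep y.rep),
    ((q.out.glued.autCard : ℂ) / (q.out.autFCard : ℂ)) •
      vec (Classes.mk (n := n) q.out.glued x.degree_rep)

/-- The product of `B_n`, extended bilinearly. -/
def mulB (n : ℕ) : B n →ₗ[ℂ] B n →ₗ[ℂ] B n := liftB fun x => liftB fun y => mulVec x y

instance (n : ℕ) : NonUnitalNonAssocRing (B n) :=
  { (inferInstance : AddCommGroup (B n)) with
    mul := fun a b => mulB n a b
    left_distrib := fun a b c => map_add (mulB n a) b c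
    right_distrib := fun a b c => LinearMap.map_add₂ (mulB n) a b c
    zero_mul := fun a => LinearMap.map_zero₂ (mulB n) a
    mul_zero := fun a => map_zero (mulB n a) }

instance (n : ℕ) : IsScalarTower ℂ (B n) (B n) :=
  ⟨fun z a b => LinearMap.map_smul₂ (mulB n) z a b⟩

instance (n : ℕ) : SMulCommClass ℂ (B n) (B n) :=
  ⟨fun z a b => (map_smul (mulB n a) z b).symm⟩

open Classical in
instance (n : ℕ) : Fintype {s : Classes n // s.rep.IsSimple} := Fintype.ofFinite _

/-- `ρ_n` of a graph `Γ` of degree `m ≤ n`.  The standard extensions of degree `n` of `Γ` are the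
graphs `Γ ⊔ S` with `S` simple of degree `n - m`; the coefficient of such a graph is
`|Aut (Γ ⊔ S)| / (|Aut Γ| |Aut S|)`. -/
def rhoVec {m n : ℕ} (h : m ≤ n) (x : Classes m) : B n :=
  ∑ s : {s : Classes (n - m) // s.rep.IsSimple},
    (((disjUnion x.rep s.1.rep).autCard : ℂ) / ((x.rep.autCard : ℂ) * (s.1.rep.autCard : ℂ))) •
      vec (Classes.mk (n := n) (disjUnion x.rep s.1.rep) (by
        rw [degree_disjUnion, Classes.degree_rep, Classes.degree_rep, Nat.add_sub_cancel' h]))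

/-- The linear map `ρ_n : B_m → B_n` for `m ≤ n`. -/
def rho {m n : ℕ} (h : m ≤ n) : B m →ₗ[ℂ] B n := liftB (rhoVec h)

/-- The elements `{Γ₁ Γ₂}_n` of `B_n`: for `n ≥ max (|Γ₁|, |Γ₂|)`,
`{Γ₁ Γ₂}_n = ρ_n(Γ₁) * ρ_n(Γ₂) - ∑ ρ_n({Γ₁ Γ₂}_k)`, the sum over `max (|Γ₁|, |Γ₂|) ≤ k < n`
(empty for `n = max (|Γ₁|, |Γ₂|)`). -/
def bracket {p q : ℕ} (x : Classes p) (y : Classes q) (n : ℕ) : B n :=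
  if h : max p q ≤ n then
    rho ((le_max_left p q).trans h) (vec x) * rho ((le_max_right p q).trans h) (vec y) -
      ∑ k : Fin n, if max p q ≤ (k : ℕ) then rho k.2.le (bracket x y (k : ℕ)) else 0
  else 0
termination_by n
decreasing_by exact k.2

/-- The vector space `B_∞` generated by all bipartite graphs (of positive degree). -/
def BInf : Type 1 := (Σ n : ℕ+, Classes n) →₀ ℂ

instance : AddCommGroup BInf := inferInstanceAs (AddCommGroup ((Σ n : ℕ+, Classes n) →₀ ℂ))
instance : Module ℂ BInf := inferInstanceAs (Module ℂ ((Σ n : ℕ+, Classes n) →₀ ℂ))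

/-- The linear map on `B_∞` with prescribed values on the basis. -/
def liftInf {M : Type 1} [AddCommGroup M] [Module ℂ M] (f : (Σ n : ℕ+, Classes n) → M) :
    BInf →ₗ[ℂ] M :=
  (Finsupp.linearCombination ℂ f : ((Σ n : ℕ+, Classes n) →₀ ℂ) →ₗ[ℂ] M)

/-- The inclusion of `B_n` into `B_∞`. -/
def incl (n : ℕ+) : B n →ₗ[ℂ] BInf :=
  liftB fun x => (Finsupp.single ⟨n, x⟩ 1 : (Σ n : ℕ+, Classes n) →₀ ℂ)

/-- `Γ₁ ∘ Γ₂ = ∑ {Γ₁ Γ₂}_n`, a sum with finitely many nonzero terms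
(the terms with `n < max (|Γ₁|, |Γ₂|)` are zero). -/
def circVec (x y : Σ n : ℕ+, Classes n) : BInf :=
  ∑ᶠ n : ℕ+, incl n (bracket x.2 y.2 n)

/-- The product `∘` of `B_∞`, extended bilinearly. -/
def circ : BInf →ₗ[ℂ] BInf →ₗ[ℂ] BInf := liftInf fun x => liftInf fun y => circVec x y

instance : NonUnitalNonAssocRing BInf :=
  { (inferInstance : AddCommGroup BInf) with
    mul := fun a b => circ a b
    left_distrib := fun a b c => map_add (circ a) b c
    right_distrib := fun a b c => LinearMap.map_add₂ circ a b c
    zero_mul := fun a => LinearMap.map_zero₂ circ a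
    mul_zero := fun a => map_zero (circ a) }

instance : IsScalarTower ℂ (BInf) (BInf) :=
  ⟨fun z a b => LinearMap.map_smul₂ (circ) z a b⟩

instance : SMulCommClass ℂ (BInf) (BInf) :=
  ⟨fun z a b => (map_smul (circ a) z b).symm⟩

/-- The algebra `B^as` of sequences `(b¹, b², …)` with `bⁿ ∈ B_n`, with componentwise operations. -/
abbrev BAs : Type 1 := ∀ n : ℕ+, B n

/-- The sequence associated with `b ∈ B_n`: its `i`-th entry is `0` for `i < n` and `ρ_i(b)` for
`i ≥ n`. -/
def asSeq {n : ℕ+} (b : B n) : BAs := fun i => if h : (n : ℕ) ≤ i then rho h b else 0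

end BipartiteGraph

end

/-! Label the edges. A graph with a fixed edge set `E` of size `n` is a pair `(P, R)` of partitions
of `E`, so an element of `B n` becomes a matrix indexed by the partitions of `E`, whose entry at
`(P, R)` is the coefficient of the class of that graph. The weights `|Aut| / |Aut_F|` are exactly
those that turn `*` into matrix multiplication (`coeff_mul`); hence `*` is associative.

In the same language the entry of `ρ_n b`, for `b` in `B m`, is a sum over the `m`-element subsets
`U` of `E` that are unions of classes of `P` and off which `P = R`, of the entry of `b` at the
restrictions of `P` and `R` to `U` (`coeff_rho`). So the entry of `ρ_n x * ρ_n y` counts triples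
`(Q, T, T')` where `(P, Q)` has class `x` on `T` and is simple off `T`, and `(Q, R)` has class `y`
on `T'` and is simple off `T'`. Off `U = T ∪ T'` the partitions `P`, `Q`, `R` agree, so the triples
with union `U` are the triples living on `U` alone and covering it (`card_contribution_res`). By
induction the entry of `{xy}_n` counts the triples with `T ∪ T' = E` (`coeff_bracket`), and there
are none when `n` exceeds the sum of the degrees.

The recursion for the brackets says that `ρ_i x * ρ_i y` is the sum of `ρ_i {xy}_k` over `k ≤ i`,
which is multiplicativity of `rhoUp` (`rhoUp_circVec`). This map is triangular for the degree with
identities on the diagonal, hence injective, and associativity of `∘` is pulled back from sequences.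
-/

noncomputable section

namespace BipartiteGraph

/-! ### Isomorphisms as bijections of the edges -/

namespace Iso

variable {Γ Γ' Γ'' : BipartiteGraph}

theorem left_iff (f : Iso Γ Γ') (a b : Γ.E) :
    Γ'.left (f.onE a) = Γ'.left (f.onE b) ↔ Γ.left a = Γ.left b := by
  rw [f.left_comm, f.left_comm, f.onV₁.apply_eq_iff_eq]

theorem right_iff (f : Iso Γ Γ') (a b : Γ.E) :
    Γ'.right (f.onE a) = Γ'.right (f.onE b) ↔ Γ.right a = Γ.right b := by
  rw [f.right_comm, f.right_comm, f.onV₂.apply_eq_iff_eq]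

/-- An isomorphism is determined by the bijection of the edges. -/
theorem onE_injective : Function.Injective (fun f : Iso Γ Γ' => f.onE) := by
  intro f g h
  have h' : f.onE = g.onE := h
  refine Iso.ext (Equiv.ext fun v => ?_) h' (Equiv.ext fun v => ?_)
  · obtain ⟨e, rfl⟩ := Γ.left_surj v
    rw [← f.left_comm, ← g.left_comm, h']
  · obtain ⟨e, rfl⟩ := Γ.right_surj v
    rw [← f.right_comm, ← g.right_comm, h']

/-- The bijection between the targets of two surjections with the same fibres. -/
def targetEquiv {α β X Y : Type} {f : α → X} {g : β → Y} (hf : Function.Surjective f)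
    (hg : Function.Surjective g) (e : α ≃ β) (h : ∀ a b, g (e a) = g (e b) ↔ f a = f b) : X ≃ Y :=
  Equiv.ofBijective (fun v => g (e (Function.surjInv hf v))) <| by
    constructor
    · intro v w hvw
      have := (h _ _).1 hvw
      rwa [Function.surjInv_eq hf, Function.surjInv_eq hf] at this
    · intro y
      obtain ⟨b, rfl⟩ := hg y
      refine ⟨f (e.symm b), ?_⟩
      have := (h (Function.surjInv hf (f (e.symm b))) (e.symm b)).2 (Function.surjInv_eq hf _)
      rwa [e.apply_symm_apply] at this

theorem targetEquiv_apply {α β X Y : Type} {f : α → X} {g : β → Y} (hf : Function.Surjective f)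
    (hg : Function.Surjective g) (e : α ≃ β) (h : ∀ a b, g (e a) = g (e b) ↔ f a = f b) (a : α) :
    targetEquiv hf hg e h (f a) = g (e a) :=
  (h _ _).2 (Function.surjInv_eq hf _)

/-- A bijection of the edges that respects incidence induces an isomorphism. -/
def ofEquiv (e : Γ.E ≃ Γ'.E)
    (hl : ∀ a b, Γ'.left (e a) = Γ'.left (e b) ↔ Γ.left a = Γ.left b)
    (hr : ∀ a b, Γ'.right (e a) = Γ'.right (e b) ↔ Γ.right a = Γ.right b) : Iso Γ Γ' where
  onV₁ := targetEquiv Γ.left_surj Γ'.left_surj e hl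
  onE := e
  onV₂ := targetEquiv Γ.right_surj Γ'.right_surj e hr
  left_comm a := (targetEquiv_apply Γ.left_surj Γ'.left_surj e hl a).symm
  right_comm a := (targetEquiv_apply Γ.right_surj Γ'.right_surj e hr a).symm

/-- The inverse isomorphism. -/
def symm (f : Iso Γ Γ') : Iso Γ' Γ :=
  ofEquiv f.onE.symm (fun a b => by rw [← f.left_iff]; simp) (fun a b => by rw [← f.right_iff]; simp)

/-- The composite of two isomorphisms. -/
def trans (f : Iso Γ Γ') (g : Iso Γ' Γ'') : Iso Γ Γ'' :=
  ofEquiv (f.onE.trans g.onE) (fun a b => by simp [g.left_iff, f.left_iff])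
    (fun a b => by simp [g.right_iff, f.right_iff])

@[simp] theorem onE_ofEquiv (e : Γ.E ≃ Γ'.E) (hl hr) : (ofEquiv e hl hr : Iso Γ Γ').onE = e := rfl

@[simp] theorem onE_symm (f : Iso Γ Γ') : f.symm.onE = f.onE.symm := rfl

@[simp] theorem onE_trans (f : Iso Γ Γ') (g : Iso Γ' Γ'') :
    (f.trans g).onE = f.onE.trans g.onE := rfl

instance : Finite (Iso Γ Γ') := Finite.of_injective _ onE_injective

instance : Nonempty (Iso Γ Γ) := isIso_equivalence.refl Γ

theorem card_eq_autCard (f : Iso Γ Γ') : Nat.card (Iso Γ Γ') = Γ.autCard :=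
  Nat.card_congr
    { toFun := fun g => g.trans f.symm
      invFun := fun g => g.trans f
      left_inv := fun g => onE_injective <| Equiv.ext fun e => by simp
      right_inv := fun g => onE_injective <| Equiv.ext fun e => by simp }

end Iso

open Classical in
-- Lets the orders of automorphism groups in the definitions of `*` and `ρ` be read as numbers of
-- isomorphisms onto a fixed labelled graph.
theorem card_iso (Γ Γ' : BipartiteGraph) :
    Nat.card (Iso Γ Γ') = if IsIso Γ Γ' then Γ.autCard else 0 := by
  split_ifs with h
  · exact h.some.card_eq_autCard
  · exact Nat.card_eq_zero.2 (Or.inl (not_nonempty_iff.1 h))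

theorem autCard_ne_zero (Γ : BipartiteGraph) : (Γ.autCard : ℂ) ≠ 0 :=
  Nat.cast_ne_zero.2 Nat.card_pos.ne'

theorem IsIso.symm {Γ Γ' : BipartiteGraph} (h : IsIso Γ Γ') : IsIso Γ' Γ :=
  isIso_equivalence.symm h

theorem IsIso.trans {Γ Γ' Γ'' : BipartiteGraph} (h : IsIso Γ Γ') (h' : IsIso Γ' Γ'') :
    IsIso Γ Γ'' :=
  isIso_equivalence.trans h h'

theorem IsIso.degree_eq {Γ Γ' : BipartiteGraph} (h : IsIso Γ Γ') : Γ.degree = Γ'.degree :=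
  Nat.card_congr h.some.onE

/-! ### Graphs as pairs of partitions of the edge set -/

/-- The bipartite graph with edge set `E` whose vertices are the classes of two equivalence
relations. -/
abbrev ofSetoids {E : Type} [Finite E] (P R : Setoid E) : BipartiteGraph where
  V₁ := Quotient P
  E := E
  V₂ := Quotient R
  finE := inferInstance
  left := Quotient.mk P
  right := Quotient.mk R
  left_surj := Quotient.mk_surjective
  right_surj := Quotient.mk_surjective

section ofSetoids

variable {E : Type} [Finite E] {P R : Setoid E}

theorem ofSetoids_left (a b : E) :
    (ofSetoids P R).left a = (ofSetoids P R).left b ↔ P a b := Quotient.eq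

theorem ofSetoids_right (a b : E) :
    (ofSetoids P R).right a = (ofSetoids P R).right b ↔ R a b := Quotient.eq

theorem degree_ofSetoids : (ofSetoids P R).degree = Nat.card E := rfl

end ofSetoids

/-- Every graph is given by two equivalence relations on its edges. -/
theorem isIso_ofSetoids_ker (Γ : BipartiteGraph) :
    IsIso (ofSetoids (Setoid.ker Γ.left) (Setoid.ker Γ.right)) Γ :=
  ⟨Iso.ofEquiv (Γ := ofSetoids (Setoid.ker Γ.left) (Setoid.ker Γ.right)) (Equiv.refl Γ.E)
    (fun _ _ => (Quotient.eq (r := Setoid.ker Γ.left)).symm)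
    (fun _ _ => (Quotient.eq (r := Setoid.ker Γ.right)).symm)⟩

instance (E : Type) [Finite E] : Finite (Setoid E) :=
  Finite.of_injective (fun s : Setoid E => fun a b => s.r a b) fun s t h => by
    ext a b
    exact iff_of_eq (congrFun (congrFun h a) b)

instance (E : Type) [Finite E] : Fintype (Setoid E) := Fintype.ofFinite _

instance (E : Type) [Finite E] : Fintype (Set E) := Fintype.ofFinite _

namespace Classes

theorem mk_eq_mk {n : ℕ} {Γ Γ' : BipartiteGraph} {h : Γ.degree = n} {h' : Γ'.degree = n} :
    mk Γ h = mk Γ' h' ↔ IsIso Γ Γ' :=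
  Quotient.eq (r := isoSetoid n)

theorem mk_eq_iff {n : ℕ} {Γ : BipartiteGraph} {h : Γ.degree = n} {x : Classes n} :
    mk Γ h = x ↔ IsIso x.rep Γ := by
  conv_lhs => rw [← mk_rep x]
  rw [mk_eq_mk]
  exact ⟨IsIso.symm, IsIso.symm⟩

/-- The class of the graph given by two equivalence relations. -/
def ofSetoids {E : Type} [Finite E] {n : ℕ} (h : Nat.card E = n) (P R : Setoid E) : Classes n :=
  mk (BipartiteGraph.ofSetoids P R) (degree_ofSetoids.trans h)

theorem ofSetoids_eq_mk {E : Type} [Finite E] {n : ℕ} {h : Nat.card E = n} {P R : Setoid E}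
    {Γ : BipartiteGraph} {h' : Γ.degree = n} :
    ofSetoids h P R = mk Γ h' ↔ IsIso Γ (BipartiteGraph.ofSetoids P R) :=
  mk_eq_mk.trans ⟨IsIso.symm, IsIso.symm⟩

theorem ofSetoids_eq_iff {E : Type} [Finite E] {n : ℕ} {h : Nat.card E = n} {P R : Setoid E}
    {x : Classes n} : ofSetoids h P R = x ↔ IsIso x.rep (BipartiteGraph.ofSetoids P R) :=
  mk_eq_iff

theorem exists_eq_ofSetoids {n : ℕ} (x : Classes n) :
    ∃ (E : Type) (_ : Finite E) (h : Nat.card E = n) (P R : Setoid E), x = ofSetoids h P R :=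
  ⟨x.rep.E, inferInstance, x.degree_rep, Setoid.ker x.rep.left, Setoid.ker x.rep.right,
    (mk_eq_iff.2 (isIso_ofSetoids_ker _).symm).symm⟩

end Classes

/-! ### Coefficients of vectors at labelled graphs -/

/-- The coefficient of an isomorphism class in a vector of `B_n`. -/
def coeff {n : ℕ} (x : Classes n) : B n →ₗ[ℂ] ℂ :=
  (Finsupp.lapply x : (Classes n →₀ ℂ) →ₗ[ℂ] ℂ)

theorem B_ext {n : ℕ} {a b : B n} (h : ∀ x, coeff x a = coeff x b) : a = b :=
  Finsupp.ext h

theorem B_ext_ofSetoids {n : ℕ} {a b : B n}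
    (h : ∀ (E : Type) [Finite E] (hE : Nat.card E = n) (P R : Setoid E),
      coeff (Classes.ofSetoids hE P R) a = coeff (Classes.ofSetoids hE P R) b) : a = b := by
  refine B_ext fun x => ?_
  obtain ⟨E, _, hE, P, R, rfl⟩ := x.exists_eq_ofSetoids
  exact h E hE P R

open Classical in
theorem coeff_vec {n : ℕ} (x y : Classes n) : coeff x (vec y) = if x = y then 1 else 0 := by
  have := Finsupp.single_apply (a := y) (a' := x) (b := (1 : ℂ))
  simp only [eq_comm (a := y)] at this
  exact this

theorem liftB_vec {n : ℕ} {M : Type 1} [AddCommGroup M] [Module ℂ M] (f : Classes n → M)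
    (x : Classes n) : liftB f (vec x) = f x :=
  (Finsupp.linearCombination_single ℂ 1 x).trans (one_smul ℂ _)

theorem B_induction {n : ℕ} {p : B n → Prop} (zero : p 0) (add : ∀ a b, p a → p b → p (a + b))
    (smul : ∀ (z : ℂ) x, p (z • vec x)) (b : B n) : p b := by
  refine Finsupp.induction_linear (motive := p) b zero add fun x z => ?_
  have h : (Finsupp.single x z : Classes n →₀ ℂ) = z • Finsupp.single x 1 := by simp
  rw [h]
  exact smul z x

/-! ### Gluings as middle partitions, and `*` as a matrix product -/

namespace Gluing

variable {Γ Γ' : BipartiteGraph}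

/-- `F` embeds the edges at `v` into the edges at `χ v`, and equal valency makes this onto, so two
vertices cannot have the same image. Thus a gluing amounts to a bijection `F` matching the right
partition of `Γ` with the left partition of `Γ'`. -/
theorem left_F_iff (g : Gluing Γ Γ') (a b : Γ.E) :
    Γ'.left (g.F a) = Γ'.left (g.F b) ↔ Γ.right a = Γ.right b := by
  rw [← g.consistent, ← g.consistent]
  refine ⟨fun h => ?_, fun h => by rw [h]⟩
  let f : {e // Γ.right e = Γ.right a} → {e' // Γ'.left e' = g.χ (Γ.right a)} :=
    fun e => ⟨g.F e.1, by rw [← g.consistent, e.2]⟩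
  have hf : Function.Injective f := fun e e' hee =>
    Subtype.ext (g.F.injective (congrArg Subtype.val hee))
  have hs : Function.Surjective f :=
    (Function.Injective.bijective_of_nat_card_le hf (g.valency _).le).2
  obtain ⟨e, he⟩ := hs ⟨g.F b, by rw [← g.consistent, h]⟩
  have : e.1 = b := g.F.injective (congrArg Subtype.val he)
  rw [← this, e.2]

/-- A gluing given by a bijection of the edges. -/
def ofEquiv (F : Γ.E ≃ Γ'.E)
    (h : ∀ a b, Γ'.left (F a) = Γ'.left (F b) ↔ Γ.right a = Γ.right b) : Gluing Γ Γ' where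
  χ := Iso.targetEquiv Γ.right_surj Γ'.left_surj F h
  valency v := by
    refine Nat.card_congr (Equiv.subtypeEquiv F fun e => ?_).symm
    rw [← Iso.targetEquiv_apply Γ.right_surj Γ'.left_surj F h, Equiv.apply_eq_iff_eq]
  F := F
  consistent := Iso.targetEquiv_apply Γ.right_surj Γ'.left_surj F h

variable {E : Type} [Finite E]

/-- The middle partitions `Q` by which the graph given by `P` and `R` is obtained from the
gluing `g`. -/
def Middle (g : Gluing Γ Γ') (P R Q : Setoid E) : Prop :=
  ∃ γ : Iso g.glued (ofSetoids P R), ∀ a b : Γ.E,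
    Q ((γ.onE : Γ.E ≃ E) a) ((γ.onE : Γ.E ≃ E) b) ↔ Γ.right a = Γ.right b

/-- An orbit count: each isomorphism onto `(P, R)` transports the right partition of `Γ` to a middle
partition, and the isomorphisms giving the same one form a coset of `Aut_F`. -/
theorem card_middle_mul (g : Gluing Γ Γ') (P R : Setoid E) :
    Nat.card {Q // g.Middle P R Q} * g.autFCard = Nat.card (Iso g.glued (ofSetoids P R)) := by
  rw [autFCard, ← Nat.card_prod]
  refine Nat.card_congr (Equiv.ofBijective
    (fun p => p.2.1.trans p.1.2.choose) ⟨?_, ?_⟩)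
  · rintro ⟨⟨Q, hQ⟩, ⟨σ, τ, hσ⟩⟩ ⟨⟨Q', hQ'⟩, ⟨σ', τ', hσ'⟩⟩ h
    -- `τ` and `σ` agree on edges, but only `τ` is known to respect `Γ.right`, so the comparison of
    -- `Q` and `Q'` goes through `τ`.
    have h1 : ∀ e : Γ.E, (hQ.choose.onE : Γ.E ≃ E) (τ.onE e) =
        (hQ'.choose.onE : Γ.E ≃ E) (τ'.onE e) := fun e => by
      have := congrArg (fun f : Iso g.glued (ofSetoids P R) => (f.onE : Γ.E ≃ E) e) h
      rw [hσ, hσ']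
      exact this
    have hQQ : Q = Q' := by
      ext a b
      obtain ⟨a, rfl⟩ := (τ.onE.trans (hQ.choose.onE : Γ.E ≃ E)).surjective a
      obtain ⟨b, rfl⟩ := (τ.onE.trans (hQ.choose.onE : Γ.E ≃ E)).surjective b
      refine ((hQ.choose_spec (τ.onE a) (τ.onE b)).trans (τ.right_iff a b)).trans ?_
      refine ((hQ'.choose_spec (τ'.onE a) (τ'.onE b)).trans (τ'.right_iff a b)).symm.trans ?_
      rw [← h1, ← h1]
      rfl
    subst hQQ
    have : σ = σ' := by
      refine Iso.onE_injective (Equiv.ext fun e => ?_)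
      have := h1 e
      rw [hσ e, hσ' e] at this
      exact (hQ.choose.onE).injective this
    subst this
    rfl
  · intro γ
    let e : Γ.E ≃ E := γ.onE
    let Q : Setoid E := Setoid.ker fun a => Γ.right (e.symm a)
    have hQ : g.Middle P R Q := ⟨γ, fun a b => by
      change Γ.right (e.symm (e a)) = Γ.right (e.symm (e b)) ↔ _
      rw [e.symm_apply_apply, e.symm_apply_apply]⟩
    refine ⟨⟨⟨Q, hQ⟩, ⟨γ.trans hQ.choose.symm, Iso.ofEquiv
      (Γ := Γ) (Γ' := Γ) (e.trans (hQ.choose.onE : Γ.E ≃ E).symm)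
      (γ.trans hQ.choose.symm).left_iff fun a b => ?_, fun _ => rfl⟩⟩, ?_⟩
    · let u : Γ.E ≃ E := hQ.choose.onE
      have hu : ∀ a b, Q (u a) (u b) ↔ Γ.right a = Γ.right b := hQ.choose_spec
      change Γ.right (u.symm (e a)) = Γ.right (u.symm (e b)) ↔ _
      rw [← hu, u.apply_symm_apply, u.apply_symm_apply]
      change Γ.right (e.symm (e a)) = Γ.right (e.symm (e b)) ↔ _
      rw [e.symm_apply_apply, e.symm_apply_apply]
    · refine Iso.onE_injective (Equiv.ext fun e => ?_)
      simp

/-- Together with `middle_of_iso`, this describes middle partitions symmetrically in the two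
factors: labellings of both graphs that `F` identifies. -/
theorem Middle.exists_iso {g : Gluing Γ Γ'} {P R Q : Setoid E} (h : g.Middle P R Q) :
    ∃ (α : Iso Γ (ofSetoids P Q)) (β : Iso Γ' (ofSetoids Q R)),
      ∀ e, (β.onE : Γ'.E ≃ E) (g.F e) = (α.onE : Γ.E ≃ E) e := by
  obtain ⟨γ, hγ⟩ := h
  refine ⟨Iso.ofEquiv (Γ' := ofSetoids P Q) (γ.onE : Γ.E ≃ E) γ.left_iff
    (fun a b => (ofSetoids_right _ _).trans (hγ a b)),
    Iso.ofEquiv (Γ' := ofSetoids Q R) (g.F.symm.trans (γ.onE : Γ.E ≃ E))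
      (fun a b => (ofSetoids_left _ _).trans ((hγ _ _).trans ?_))
      (fun a b => (γ.right_iff _ _).trans ?_), fun e => ?_⟩
  · rw [← g.left_F_iff]
    simp
  · change Γ'.right (g.F _) = Γ'.right (g.F _) ↔ _
    simp
  · exact congrArg (γ.onE : Γ.E ≃ E) (g.F.symm_apply_apply e)

theorem middle_of_iso {g : Gluing Γ Γ'} {P R Q : Setoid E} (α : Iso Γ (ofSetoids P Q))
    (β : Iso Γ' (ofSetoids Q R))
    (h : ∀ e, (β.onE : Γ'.E ≃ E) (g.F e) = (α.onE : Γ.E ≃ E) e) : g.Middle P R Q := by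
  refine ⟨Iso.ofEquiv (Γ := g.glued) (Γ' := ofSetoids P R) (α.onE : Γ.E ≃ E)
    α.left_iff (fun a b => ?_), fun a b => ?_⟩
  · change (ofSetoids Q R).right ((α.onE : Γ.E ≃ E) a) = (ofSetoids Q R).right ((α.onE : Γ.E ≃ E) b)
      ↔ Γ'.right (g.F a) = Γ'.right (g.F b)
    rw [← h a, ← h b]
    exact β.right_iff _ _
  · exact (ofSetoids_right (P := P) _ _).symm.trans (α.right_iff a b)

theorem Middle.of_equiv {g h : Gluing Γ Γ'} {P R Q : Setoid E} (hg : g.Middle P R Q)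
    (H : Gluing.equiv Γ Γ' g h) : h.Middle P R Q := by
  obtain ⟨α, β, hαβ⟩ := hg.exists_iso
  obtain ⟨a, a', H⟩ := H
  refine middle_of_iso (a.symm.trans α) (a'.symm.trans β) fun e => ?_
  have := H (a.onE.symm e)
  rw [Equiv.apply_symm_apply] at this
  change (β.onE : Γ'.E ≃ E) (a'.onE.symm (h.F e)) = (α.onE : Γ.E ≃ E) (a.onE.symm e)
  rw [this, Equiv.symm_apply_apply, hαβ]

/-- Two labellings of `Γ` by the same `(P, Q)` differ by an automorphism, and likewise for `Γ'`. So
inequivalent gluings share no middle partition. -/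
theorem Middle.equiv {g h : Gluing Γ Γ'} {P R Q : Setoid E} (hg : g.Middle P R Q)
    (hh : h.Middle P R Q) : Gluing.equiv Γ Γ' g h := by
  obtain ⟨α, β, h1⟩ := hg.exists_iso
  obtain ⟨α', β', h2⟩ := hh.exists_iso
  refine ⟨α.trans α'.symm, β.trans β'.symm, fun e => ?_⟩
  change h.F ((α'.onE : Γ.E ≃ E).symm ((α.onE : Γ.E ≃ E) e)) =
    (β'.onE : Γ'.E ≃ E).symm ((β.onE : Γ'.E ≃ E) (g.F e))
  rw [Equiv.eq_symm_apply, h2, Equiv.apply_symm_apply, h1]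

theorem sum_card_middle (P R : Setoid E) :
    ∑ q : Quotient (Gluing.equiv Γ Γ'), Nat.card {Q // q.out.Middle P R Q} =
      Nat.card {Q : Setoid E // IsIso Γ (ofSetoids P Q) ∧ IsIso Γ' (ofSetoids Q R)} := by
  rw [← Nat.card_sigma]
  refine Nat.card_congr (Equiv.ofBijective (fun p => ⟨p.2.1, ?_⟩) ⟨?_, ?_⟩)
  · obtain ⟨α, β, -⟩ := p.2.2.exists_iso
    exact ⟨⟨α⟩, ⟨β⟩⟩
  · rintro ⟨q, Q, hQ⟩ ⟨q', Q', hQ'⟩ h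
    obtain rfl : Q = Q' := congrArg Subtype.val h
    obtain rfl : q = q' := Quotient.out_equiv_out.1 (hQ.equiv hQ')
    rfl
  · rintro ⟨Q, ⟨α⟩, ⟨β⟩⟩
    -- Labelling the edges of both graphs by `E` identifies them with each other; `Q` is the common
    -- partition along which they are glued.
    let g : Gluing Γ Γ' := ofEquiv ((α.onE : Γ.E ≃ E).trans (β.onE : Γ'.E ≃ E).symm) fun a b => by
      rw [← β.left_iff, ← α.right_iff, Equiv.trans_apply, Equiv.trans_apply,
        Equiv.apply_symm_apply, Equiv.apply_symm_apply]
    have hg : g.Middle P R Q := middle_of_iso α β fun e => (β.onE : Γ'.E ≃ E).apply_symm_apply _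
    exact ⟨⟨Quotient.mk _ g, Q, hg.of_equiv (Setoid.symm' _ (Quotient.mk_out g))⟩, rfl⟩

theorem autFCard_ne_zero (g : Gluing Γ Γ') : (g.autFCard : ℂ) ≠ 0 := by
  have : Nonempty {σ : g.glued.Aut // ∃ τ : Γ.Aut, ∀ e : Γ.E, τ.onE e = σ.onE e} :=
    ⟨⟨Equiv.refl _, Equiv.refl _, Equiv.refl _, fun _ => rfl, fun _ => rfl⟩,
      ⟨Equiv.refl _, Equiv.refl _, Equiv.refl _, fun _ => rfl, fun _ => rfl⟩, fun _ => rfl⟩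
  exact Nat.cast_ne_zero.2 Nat.card_pos.ne'

end Gluing

/-- By `card_middle_mul`, the weight `|Aut| / |Aut_F|` of a gluing whose glued graph is `(P, R)` is
its number of middle partitions; summing over the classes of gluings counts each admissible `Q`
once. -/
theorem coeff_mulVec {n : ℕ} (x y : Classes n) {E : Type} [Finite E] (hE : Nat.card E = n)
    (P R : Setoid E) :
    coeff (Classes.ofSetoids hE P R) (mulVec x y) =
      Nat.card {Q : Setoid E // IsIso x.rep (ofSetoids P Q) ∧ IsIso y.rep (ofSetoids Q R)} := by
  classical
  rw [mulVec, map_sum, ← Gluing.sum_card_middle, Nat.cast_sum]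
  refine Finset.sum_congr rfl fun q _ => ?_
  have h := congrArg (Nat.cast (R := ℂ)) (q.out.card_middle_mul P R)
  rw [card_iso, Nat.cast_mul, ← eq_div_iff q.out.autFCard_ne_zero] at h
  have hc : Classes.ofSetoids hE P R = Classes.mk (n := n) q.out.glued x.degree_rep ↔
      IsIso q.out.glued (ofSetoids P R) := Classes.ofSetoids_eq_mk
  rw [h, map_smul, coeff_vec]
  by_cases hi : IsIso q.out.glued (ofSetoids P R)
  · rw [if_pos hi, if_pos (hc.2 hi), smul_eq_mul, mul_one]
  · rw [if_neg hi, if_neg (mt hc.1 hi), smul_zero, Nat.cast_zero, zero_div]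

theorem mul_def {n : ℕ} (a b : B n) : a * b = mulB n a b := rfl

theorem vec_mul_vec {n : ℕ} (x y : Classes n) : vec x * vec y = mulVec x y := by
  rw [mul_def, mulB, liftB_vec, liftB_vec]

/-- The product of `B_n` is a product of matrices indexed by the partitions of the edges. -/
theorem coeff_mul {n : ℕ} (a b : B n) {E : Type} [Finite E] (hE : Nat.card E = n)
    (P R : Setoid E) :
    coeff (Classes.ofSetoids hE P R) (a * b) =
      ∑ Q : Setoid E, coeff (Classes.ofSetoids hE P Q) a * coeff (Classes.ofSetoids hE Q R) b := by
  classical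
  induction a using B_induction with
  | zero => simp
  | add a a' h h' => simp [add_mul, h, h', Finset.sum_add_distrib]
  | smul z x =>
    induction b using B_induction with
    | zero => simp
    | add b b' h h' => simp only [mul_add, map_add, h, h', Finset.sum_add_distrib]
    | smul w y =>
      rw [smul_mul_smul_comm, map_smul, vec_mul_vec, coeff_mulVec, Nat.card_eq_fintype_card,
        Fintype.card_subtype, Finset.card_filter, Nat.cast_sum, Finset.smul_sum]
      refine Finset.sum_congr rfl fun Q _ => ?_
      simp only [map_smul, coeff_vec, Classes.ofSetoids_eq_iff, smul_eq_mul]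
      by_cases hx : IsIso x.rep (ofSetoids P Q) <;> by_cases hy : IsIso y.rep (ofSetoids Q R) <;>
        simp [hx, hy]

theorem B_mul_assoc {n : ℕ} (a b c : B n) : a * b * c = a * (b * c) := by
  refine B_ext_ofSetoids fun E _ hE P R => ?_
  simp only [coeff_mul, Finset.sum_mul, Finset.mul_sum, mul_assoc]
  -- Both sides are the same double sum over the two inner partitions.
  exact Finset.sum_comm

/-! ### Simple graphs: the two partitions coincide -/

section IsSimple

variable (Γ : BipartiteGraph)

theorem adj_left_right (e : Γ.E) :
    Γ.toSimpleGraph.Adj (Sum.inl (Γ.left e)) (Sum.inr (Γ.right e)) := by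
  rw [toSimpleGraph, SimpleGraph.fromRel_adj]
  exact ⟨Sum.inl_ne_inr, Or.inl ⟨e, rfl, rfl⟩⟩

theorem isSimple_iff :
    Γ.IsSimple ↔ ∀ a b, Γ.left a = Γ.left b ↔ Γ.right a = Γ.right b := by
  constructor
  · intro h
    -- A component with two vertices leaves no room for two different neighbours of a vertex.
    have key : ∀ (c : Γ.toSimpleGraph.ConnectedComponent) (x y z : Γ.V₁ ⊕ Γ.V₂), x ∈ c.supp →
        y ∈ c.supp → z ∈ c.supp → x ≠ y → x ≠ z → y = z := by
      intro c x y z hx hy hz hxy hxz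
      by_contra hyz
      have h3 : ({x, y, z} : Set (Γ.V₁ ⊕ Γ.V₂)).ncard = 3 :=
        Set.ncard_eq_three.2 ⟨x, y, z, hxy, hxz, hyz, rfl⟩
      have hsub : ({x, y, z} : Set (Γ.V₁ ⊕ Γ.V₂)) ⊆ c.supp := by
        rintro w (rfl | rfl | rfl) <;> assumption
      have := Set.ncard_le_ncard hsub (Set.toFinite _)
      rw [h c, h3] at this
      omega
    have mem : ∀ {v w}, Γ.toSimpleGraph.Adj v w →
        w ∈ (Γ.toSimpleGraph.connectedComponentMk v).supp := fun hvw =>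
      SimpleGraph.ConnectedComponent.sound hvw.symm.reachable
    intro a b
    constructor
    · intro hab
      have hb := Γ.adj_left_right b
      rw [← hab] at hb
      exact Sum.inr_injective (key _ (Sum.inl (Γ.left a)) _ _ rfl (mem (Γ.adj_left_right a))
        (mem hb) Sum.inl_ne_inr Sum.inl_ne_inr)
    · intro hab
      have hb := Γ.adj_left_right b
      rw [← hab] at hb
      exact Sum.inl_injective (key _ (Sum.inr (Γ.right a)) _ _ rfl
        (mem (Γ.adj_left_right a).symm) (mem hb.symm) Sum.inr_ne_inl Sum.inr_ne_inl)
  · intro h c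
    obtain ⟨e, he⟩ : ∃ e, Γ.toSimpleGraph.connectedComponentMk (Sum.inl (Γ.left e)) = c := by
      induction c using SimpleGraph.ConnectedComponent.ind with | _ v =>
      rcases v with v | v
      · obtain ⟨e, rfl⟩ := Γ.left_surj v
        exact ⟨e, rfl⟩
      · obtain ⟨e, rfl⟩ := Γ.right_surj v
        exact ⟨e, SimpleGraph.ConnectedComponent.sound (Γ.adj_left_right e).reachable⟩
    subst he
    rw [Set.ncard_eq_two]
    refine ⟨Sum.inl (Γ.left e), Sum.inr (Γ.right e), Sum.inl_ne_inr, Set.Subset.antisymm ?_ ?_⟩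
    -- The two ends of `e` are closed under adjacency, so a walk from one of them never leaves the
    -- pair.
    · intro w hw
      have hr := (SimpleGraph.ConnectedComponent.exact hw).symm
      rw [SimpleGraph.reachable_iff_reflTransGen] at hr
      induction hr with
      | refl => exact Or.inl rfl
      | @tail v w hv hvw ih =>
        have ih := ih (SimpleGraph.ConnectedComponent.sound
          ((SimpleGraph.reachable_iff_reflTransGen _ _).2 hv).symm)
        rw [toSimpleGraph, SimpleGraph.fromRel_adj] at hvw
        obtain ⟨-, ⟨e', rfl, rfl⟩ | ⟨e', rfl, rfl⟩⟩ := hvw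
        · rcases ih with ih | ih
          · exact Or.inr (congrArg Sum.inr ((h _ _).1 (Sum.inl_injective ih)))
          · exact absurd ih Sum.inl_ne_inr
        · rcases ih with ih | ih
          · exact absurd ih Sum.inr_ne_inl
          · exact Or.inl (congrArg Sum.inl ((h _ _).2 (Sum.inr_injective ih)))
    · rintro w (rfl | rfl)
      · rfl
      · exact SimpleGraph.ConnectedComponent.sound (Γ.adj_left_right e).symm.reachable

end IsSimple

theorem IsIso.isSimple {Γ Γ' : BipartiteGraph} (h : IsIso Γ Γ') (hs : Γ.IsSimple) :
    Γ'.IsSimple := by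
  obtain ⟨f⟩ := h
  rw [isSimple_iff] at hs ⊢
  intro a b
  rw [← f.symm.left_iff, ← f.symm.right_iff]
  exact hs _ _

/-! ### Restriction to a set of edges, and disjoint unions -/

section Restriction

variable {E : Type}

/-- The restriction of an equivalence relation to a subset. -/
abbrev res (U : Set E) (P : Setoid E) : Setoid U := P.comap Subtype.val

/-- The subset `U` is a union of classes of both `P` and `R`. -/
def Sat (U : Set E) (P R : Setoid E) : Prop :=
  (∀ a b, P a b → (a ∈ U ↔ b ∈ U)) ∧ ∀ a b, R a b → (a ∈ U ↔ b ∈ U)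

/-- The subset `U` is a union of classes of `P`, and `P` and `R` agree off `U`. -/
def Good (U : Set E) (P R : Setoid E) : Prop :=
  (∀ a b, P a b → (a ∈ U ↔ b ∈ U)) ∧ ∀ a b, a ∉ U → (P a b ↔ R a b)

theorem Good.symm {U : Set E} {P R : Setoid E} (h : Good U P R) : Good U R P := by
  refine ⟨fun a b hab => ?_, fun a b ha => (h.2 a b ha).symm⟩
  by_cases ha : a ∈ U
  · refine iff_of_true ha ?_
    by_contra hb
    exact hb ((h.1 _ _ ((h.2 b a hb).2 (R.symm hab))).2 ha)
  · exact h.1 a b ((h.2 a b ha).2 hab)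

theorem good_univ (P R : Setoid E) : Good Set.univ P R :=
  ⟨fun _ _ _ => by simp, fun _ _ h => absurd trivial h⟩

variable [Finite E] {P R : Setoid E}

/-- Relates `Good` to standard extensions: `(P, R)` splits as the graph on `U` and a simple graph on
the complement. -/
theorem good_iff (U : Set E) :
    Good U P R ↔ Sat U P R ∧ (ofSetoids (res Uᶜ P) (res Uᶜ R)).IsSimple := by
  have hs : (ofSetoids (res Uᶜ P) (res Uᶜ R)).IsSimple ↔
      ∀ a b : ↥Uᶜ, P a b ↔ R a b :=
    (isSimple_iff _).trans (forall_congr' fun a => forall_congr' fun b =>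
      iff_congr (ofSetoids_left a b) (ofSetoids_right a b))
  rw [hs]
  constructor
  · exact fun h => ⟨⟨h.1, h.symm.1⟩, fun a b => h.2 _ _ a.2⟩
  · rintro ⟨h, hs⟩
    refine ⟨h.1, fun a b ha => ?_⟩
    by_cases hb : b ∈ U
    · exact iff_of_false (fun hab => ha ((h.1 _ _ hab).2 hb)) fun hab => ha ((h.2 _ _ hab).2 hb)
    · exact hs ⟨a, ha⟩ ⟨b, hb⟩

open Classical in
/-- The isomorphism on a disjoint union given by isomorphisms on complementary parts. -/
def Iso.ofParts {Γ S : BipartiteGraph} {T : Set E} (hT : Sat T P R)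
    (α : Iso Γ (ofSetoids (res T P) (res T R)))
    (β : Iso S (ofSetoids (res Tᶜ P) (res Tᶜ R))) : Iso (disjUnion Γ S) (ofSetoids P R) :=
  Iso.ofEquiv (Γ := disjUnion Γ S) (Γ' := ofSetoids P R)
    ((Equiv.sumCongr α.onE β.onE).trans (Equiv.Set.sumCompl T))
    (by
      rintro (a | a) (b | b)
      · refine ((ofSetoids_left _ _).trans ?_).trans Sum.inl_injective.eq_iff.symm
        exact (ofSetoids_left (P := res T P) (R := res T R) _ _).symm.trans (α.left_iff a b)
      · exact iff_of_false (fun h => (β.onE b).2 ((hT.1 _ _ (Quotient.exact h)).1 (α.onE a).2))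
          Sum.inl_ne_inr
      · exact iff_of_false (fun h => (β.onE a).2 ((hT.1 _ _ (Quotient.exact h)).2 (α.onE b).2))
          Sum.inr_ne_inl
      · refine ((ofSetoids_left _ _).trans ?_).trans Sum.inr_injective.eq_iff.symm
        exact (ofSetoids_left (P := res Tᶜ P) (R := res Tᶜ R) _ _).symm.trans (β.left_iff a b))
    (by
      rintro (a | a) (b | b)
      · refine ((ofSetoids_right _ _).trans ?_).trans Sum.inl_injective.eq_iff.symm
        exact (ofSetoids_right (P := res T P) (R := res T R) _ _).symm.trans (α.right_iff a b)
      · exact iff_of_false (fun h => (β.onE b).2 ((hT.2 _ _ (Quotient.exact h)).1 (α.onE a).2))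
          Sum.inl_ne_inr
      · exact iff_of_false (fun h => (β.onE a).2 ((hT.2 _ _ (Quotient.exact h)).2 (α.onE b).2))
          Sum.inr_ne_inl
      · refine ((ofSetoids_right _ _).trans ?_).trans Sum.inr_injective.eq_iff.symm
        exact (ofSetoids_right (P := res Tᶜ P) (R := res Tᶜ R) _ _).symm.trans (β.right_iff a b))

theorem Iso.ofParts_inl {Γ S : BipartiteGraph} {T : Set E} (hT : Sat T P R)
    (α : Iso Γ (ofSetoids (res T P) (res T R)))
    (β : Iso S (ofSetoids (res Tᶜ P) (res Tᶜ R))) (a : Γ.E) :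
    ((ofParts hT α β).onE : Γ.E ⊕ S.E ≃ E) (Sum.inl a) = ((α.onE a : T) : E) := rfl

theorem Iso.ofParts_inr {Γ S : BipartiteGraph} {T : Set E} (hT : Sat T P R)
    (α : Iso Γ (ofSetoids (res T P) (res T R)))
    (β : Iso S (ofSetoids (res Tᶜ P) (res Tᶜ R))) (a : S.E) :
    ((ofParts hT α β).onE : Γ.E ⊕ S.E ≃ E) (Sum.inr a) = ((β.onE a : ↥Tᶜ) : E) := rfl

theorem Iso.range_ofParts {Γ S : BipartiteGraph} {T : Set E} (hT : Sat T P R)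
    (α : Iso Γ (ofSetoids (res T P) (res T R)))
    (β : Iso S (ofSetoids (res Tᶜ P) (res Tᶜ R))) :
    Set.range (fun a : Γ.E => ((ofParts hT α β).onE : Γ.E ⊕ S.E ≃ E) (Sum.inl a)) = T := by
  ext t
  constructor
  · rintro ⟨a, rfl⟩
    exact (α.onE a).2
  · intro ht
    obtain ⟨a, ha⟩ := α.onE.surjective (⟨t, ht⟩ : T)
    exact ⟨a, congrArg (Subtype.val : T → E) ha⟩

theorem Iso.exists_ofParts {Γ S : BipartiteGraph} (γ : Iso (disjUnion Γ S) (ofSetoids P R)) :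
    ∃ (T : Set E) (hT : Sat T P R) (α : Iso Γ (ofSetoids (res T P) (res T R)))
      (β : Iso S (ofSetoids (res Tᶜ P) (res Tᶜ R))), ofParts hT α β = γ := by
  let g : Γ.E ⊕ S.E ≃ E := γ.onE
  have hl : ∀ a b, P (g a) (g b) ↔ Sum.map Γ.left S.left a = Sum.map Γ.left S.left b :=
    fun a b => (ofSetoids_left _ _).symm.trans (γ.left_iff a b)
  have hr : ∀ a b, R (g a) (g b) ↔ Sum.map Γ.right S.right a = Sum.map Γ.right S.right b :=
    fun a b => (ofSetoids_right _ _).symm.trans (γ.right_iff a b)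
  let T : Set E := {t | (g.symm t).isLeft}
  have hinl : ∀ a, g (Sum.inl a) ∈ T := fun a => by simp [T]
  have hinr : ∀ a, g (Sum.inr a) ∈ Tᶜ := fun a => by simp [T]
  have hT : Sat T P R := by
    constructor <;> intro a b hab <;> obtain ⟨a, rfl⟩ := g.surjective a <;>
      obtain ⟨b, rfl⟩ := g.surjective b
    · rw [hl] at hab
      rcases a with a | a <;> rcases b with b | b <;> simp_all [T]
    · rw [hr] at hab
      rcases a with a | a <;> rcases b with b | b <;> simp_all [T]
  let u : Γ.E ≃ T := Equiv.ofBijective (fun a => ⟨g (Sum.inl a), hinl a⟩) (by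
    constructor
    · intro a b hab
      exact Sum.inl_injective (g.injective (congrArg Subtype.val hab))
    · rintro ⟨t, ht⟩
      obtain ⟨a | a, rfl⟩ := g.surjective t
      · exact ⟨a, rfl⟩
      · exact absurd ht (hinr a))
  let v : S.E ≃ ↥Tᶜ := Equiv.ofBijective (fun a => ⟨g (Sum.inr a), hinr a⟩) (by
    constructor
    · intro a b hab
      exact Sum.inr_injective (g.injective (congrArg Subtype.val hab))
    · rintro ⟨t, ht⟩
      obtain ⟨a | a, rfl⟩ := g.surjective t
      · exact absurd (hinl a) ht
      · exact ⟨a, rfl⟩)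
  refine ⟨T, hT,
    Iso.ofEquiv (Γ' := ofSetoids (res T P) (res T R)) u
      (fun a b => (ofSetoids_left _ _).trans ((hl (Sum.inl a) (Sum.inl b)).trans
        Sum.inl_injective.eq_iff))
      (fun a b => (ofSetoids_right _ _).trans ((hr (Sum.inl a) (Sum.inl b)).trans
        Sum.inl_injective.eq_iff)),
    Iso.ofEquiv (Γ' := ofSetoids (res Tᶜ P) (res Tᶜ R)) v
      (fun a b => (ofSetoids_left _ _).trans ((hl (Sum.inr a) (Sum.inr b)).trans
        Sum.inr_injective.eq_iff))
      (fun a b => (ofSetoids_right _ _).trans ((hr (Sum.inr a) (Sum.inr b)).trans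
        Sum.inr_injective.eq_iff)), ?_⟩
  refine Iso.onE_injective (Equiv.ext ?_)
  rintro (a | a) <;> rfl

variable (P R) in
open Classical in
-- An isomorphism from `Γ ⊔ S` amounts to the image `T` of the edges of `Γ`, which no vertex
-- connects to its complement, and an isomorphism on each part.
theorem card_iso_disjUnion (Γ S : BipartiteGraph) :
    Nat.card (Iso (disjUnion Γ S) (ofSetoids P R)) =
      ∑ T : Set E, if Sat T P R then
        Nat.card (Iso Γ (ofSetoids (res T P) (res T R))) *
          Nat.card (Iso S (ofSetoids (res Tᶜ P) (res Tᶜ R))) else 0 := by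
  have h : ∀ T : Set E, (if Sat T P R then
      Nat.card (Iso Γ (ofSetoids (res T P) (res T R))) *
        Nat.card (Iso S (ofSetoids (res Tᶜ P) (res Tᶜ R))) else 0) =
      Nat.card {_p : Iso Γ (ofSetoids (res T P) (res T R)) ×
        Iso S (ofSetoids (res Tᶜ P) (res Tᶜ R)) // Sat T P R} := by
    intro T
    split_ifs with hT
    · rw [← Nat.card_prod]
      exact Nat.card_congr (Equiv.subtypeUnivEquiv fun _ => hT).symm
    · have : IsEmpty {_p : Iso Γ (ofSetoids (res T P) (res T R)) ×
        Iso S (ofSetoids (res Tᶜ P) (res Tᶜ R)) // Sat T P R} := ⟨fun p => hT p.2⟩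
      exact Nat.card_of_isEmpty.symm
  rw [Finset.sum_congr rfl fun T _ => h T, ← Nat.card_sigma]
  refine (Nat.card_congr (Equiv.ofBijective (fun p => Iso.ofParts p.2.2 p.2.1.1 p.2.1.2)
    ⟨?_, ?_⟩)).symm
  · rintro ⟨T, ⟨α, β⟩, hT⟩ ⟨T', ⟨α', β'⟩, hT'⟩ h
    have h : Iso.ofParts hT α β = Iso.ofParts hT' α' β' := h
    obtain rfl : T = T' := by
      rw [← Iso.range_ofParts hT α β, h, Iso.range_ofParts]
    obtain rfl : α = α' := Iso.onE_injective (Equiv.ext fun a => by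
      have := Iso.ofParts_inl hT α β a
      rw [h, Iso.ofParts_inl] at this
      exact Subtype.ext this.symm)
    obtain rfl : β = β' := Iso.onE_injective (Equiv.ext fun a => by
      have := Iso.ofParts_inr hT α β a
      rw [h, Iso.ofParts_inr] at this
      exact Subtype.ext this.symm)
    rfl
  · intro γ
    obtain ⟨T, hT, α, β, rfl⟩ := γ.exists_ofParts
    exact ⟨⟨T, ⟨α, β⟩, hT⟩, rfl⟩

end Restriction

/-! ### The coefficients of `ρ` -/

open Classical in
theorem sum_isIso_simple {k : ℕ} (Γ : BipartiteGraph) (h : Γ.degree = k) :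
    (∑ s : {s : Classes k // s.rep.IsSimple}, if IsIso s.1.rep Γ then (1 : ℂ) else 0) =
      if Γ.IsSimple then 1 else 0 := by
  split_ifs with hs
  · have hs' : (Classes.mk Γ h).rep.IsSimple := (Classes.rep_mk Γ h).symm.isSimple hs
    rw [Finset.sum_eq_single ⟨Classes.mk Γ h, hs'⟩, if_pos (Classes.rep_mk Γ h)]
    · rintro ⟨s, hs⟩ - hne
      refine if_neg fun hi => hne (Subtype.ext ?_)
      exact (Classes.mk_eq_iff.2 hi).symm
    · exact fun h => absurd (Finset.mem_univ _) h
  · exact Finset.sum_eq_zero fun s _ => if_neg fun hi => hs (hi.isSimple s.2)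

open Classical in
-- Where it is nonzero, `|Aut (Γ ⊔ S)|` counts isomorphisms onto `(P, R)`. Splitting these by
-- `card_iso_disjUnion` and dividing by `|Aut Γ| |Aut S|` leaves indicators, and summing over `S`
-- only asks that the complement of `U` be simple.
theorem coeff_rhoVec {m n : ℕ} (h : m ≤ n) (x : Classes m) {E : Type} [Finite E]
    (hE : Nat.card E = n) (P R : Setoid E) :
    coeff (Classes.ofSetoids hE P R) (rhoVec h x) =
      ∑ U : Set E, if Good U P R ∧ IsIso x.rep (ofSetoids (res U P) (res U R)) then 1 else 0 := by
  have hs : ∀ s : {s : Classes (n - m) // s.rep.IsSimple},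
      coeff (Classes.ofSetoids hE P R)
        ((((disjUnion x.rep s.1.rep).autCard : ℂ) / ((x.rep.autCard : ℂ) * (s.1.rep.autCard : ℂ))) •
          vec (Classes.mk (n := n) (disjUnion x.rep s.1.rep) (by
            rw [degree_disjUnion, Classes.degree_rep, Classes.degree_rep,
              Nat.add_sub_cancel' h]))) =
      ∑ U : Set E, if Sat U P R ∧ IsIso x.rep (ofSetoids (res U P) (res U R)) then
        (if IsIso s.1.rep (ofSetoids (res Uᶜ P) (res Uᶜ R)) then 1 else 0) else 0 := by
    intro s
    have hc := congrArg (Nat.cast (R := ℂ)) (card_iso_disjUnion P R x.rep s.1.rep)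
    simp only [card_iso] at hc
    have h1 : coeff (Classes.ofSetoids hE P R)
        ((((disjUnion x.rep s.1.rep).autCard : ℂ) / ((x.rep.autCard : ℂ) * (s.1.rep.autCard : ℂ))) •
          vec (Classes.mk (n := n) (disjUnion x.rep s.1.rep) (by
            rw [degree_disjUnion, Classes.degree_rep, Classes.degree_rep,
              Nat.add_sub_cancel' h]))) =
        ((if IsIso (disjUnion x.rep s.1.rep) (ofSetoids P R) then
          (disjUnion x.rep s.1.rep).autCard else 0 : ℕ) : ℂ) /
            ((x.rep.autCard : ℂ) * (s.1.rep.autCard : ℂ)) := by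
      rw [map_smul, coeff_vec]
      by_cases hi : IsIso (disjUnion x.rep s.1.rep) (ofSetoids P R)
      · rw [if_pos hi, if_pos (Classes.ofSetoids_eq_mk.2 hi), smul_eq_mul, mul_one]
      · rw [if_neg hi, if_neg (mt Classes.ofSetoids_eq_mk.1 hi), smul_zero,
          Nat.cast_zero, zero_div]
    rw [h1, hc, Nat.cast_sum, Finset.sum_div]
    refine Finset.sum_congr rfl fun U _ => ?_
    have hx := autCard_ne_zero x.rep
    have hs := autCard_ne_zero s.1.rep
    by_cases hU : Sat U P R <;>
      by_cases h2 : IsIso x.rep (ofSetoids (res U P) (res U R)) <;>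
      by_cases h3 : IsIso s.1.rep (ofSetoids (res Uᶜ P) (res Uᶜ R)) <;>
      simp [hU, h2, h3, hx, hs]
  rw [rhoVec, map_sum, Finset.sum_congr rfl fun s _ => hs s, Finset.sum_comm]
  refine Finset.sum_congr rfl fun U _ => ?_
  by_cases hU : Sat U P R ∧ IsIso x.rep (ofSetoids (res U P) (res U R))
  · simp only [if_pos hU]
    have hd : (ofSetoids (res Uᶜ P) (res Uᶜ R)).degree = n - m := by
      have h1 : m = Nat.card U := x.degree_rep.symm.trans hU.2.degree_eq
      have h2 := Nat.card_congr (Equiv.Set.sumCompl U)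
      rw [Nat.card_sum, hE, ← h1] at h2
      rw [degree_ofSetoids]
      omega
    rw [sum_isIso_simple _ hd]
    simp only [good_iff, hU, true_and, and_true]
  · simp only [if_neg hU, Finset.sum_const_zero]
    rw [if_neg]
    rw [good_iff]
    tauto

open Classical in
/-- The coefficients of `ρ_n b`. -/
theorem coeff_rho {m n : ℕ} (h : m ≤ n) (b : B m) {E : Type} [Finite E]
    (hE : Nat.card E = n) (P R : Setoid E) :
    coeff (Classes.ofSetoids hE P R) (rho h b) =
      ∑ U : Set E, if hU : Good U P R ∧ Nat.card U = m then
        coeff (Classes.ofSetoids hU.2 (res U P) (res U R)) b else 0 := by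
  induction b using B_induction with
  | zero => simp
  | add a b ha hb =>
    rw [map_add, map_add, ha, hb, ← Finset.sum_add_distrib]
    refine Finset.sum_congr rfl fun U _ => ?_
    split_ifs <;> simp
  | smul z x =>
    rw [map_smul, map_smul, rho, liftB_vec, coeff_rhoVec, Finset.smul_sum]
    refine Finset.sum_congr rfl fun U _ => ?_
    split_ifs with h1 h2 h2
    · rw [map_smul, coeff_vec, if_pos (Classes.ofSetoids_eq_iff.2 h1.2)]
    · exact absurd ⟨h1.1, h1.2.degree_eq.symm.trans x.degree_rep⟩ h2
    · rw [map_smul, coeff_vec, if_neg fun h => h1 ⟨h2.1, Classes.ofSetoids_eq_iff.1 h⟩]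
    · simp

/-! ### Restricting partitions to a subset and gluing them back -/

variable {E : Type}

/-- The graph given by `P` and `Q` is of class `x` on `T` and simple off `T`. -/
def Part [Finite E] {p : ℕ} (x : Classes p) (T : Set E) (P Q : Setoid E) : Prop :=
  Good T P Q ∧ IsIso x.rep (ofSetoids (res T P) (res T Q))

theorem Part.card_eq [Finite E] {p : ℕ} {x : Classes p} {T : Set E} {P Q : Setoid E}
    (h : Part x T P Q) : Nat.card T = p :=
  h.2.degree_eq.symm.trans x.degree_rep

theorem Part.card_le [Finite E] {p : ℕ} {x : Classes p} {T : Set E} {P Q : Setoid E}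
    (h : Part x T P Q) : p ≤ Nat.card E :=
  h.card_eq ▸ Nat.card_le_card_of_injective _ Subtype.val_injective

/-- Off both sets the three partitions coincide, and off `T` a class of `P` is a class of `Q`. This
makes the union of the two subsets of a contribution eligible in `coeff_rho`. -/
theorem Good.union {T T' : Set E} {P Q R : Setoid E} (h : Good T P Q) (h' : Good T' Q R) :
    Good (T ∪ T') P R := by
  refine ⟨fun a b hab => ?_, fun a b ha => ?_⟩
  · have h1 := h.1 a b hab
    by_cases ha : a ∈ T
    · exact iff_of_true (Or.inl ha) (Or.inl (h1.1 ha))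
    · exact or_congr h1 (h'.1 a b ((h.2 a b ha).1 hab))
  · exact (h.2 a b fun hT => ha (Or.inl hT)).trans (h'.2 a b fun hT => ha (Or.inr hT))

/-- The equivalence relation that is `Q` on `U` and `P` off `U`. -/
def glue (U : Set E) (Q : Setoid U) (P : Setoid E) : Setoid E where
  r a b := (∃ (ha : a ∈ U) (hb : b ∈ U), Q ⟨a, ha⟩ ⟨b, hb⟩) ∨ (a ∉ U ∧ b ∉ U ∧ P a b)
  iseqv :=
    { refl := fun a => by
        by_cases ha : a ∈ U
        · exact Or.inl ⟨ha, ha, Q.refl _⟩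
        · exact Or.inr ⟨ha, ha, P.refl _⟩
      symm := by
        rintro a b (⟨ha, hb, h⟩ | ⟨ha, hb, h⟩)
        · exact Or.inl ⟨hb, ha, Q.symm h⟩
        · exact Or.inr ⟨hb, ha, P.symm h⟩
      trans := by
        rintro a b c (⟨ha, hb, h⟩ | ⟨ha, hb, h⟩) (⟨hb', hc, h'⟩ | ⟨hb', hc, h'⟩)
        · exact Or.inl ⟨ha, hc, Q.trans h h'⟩
        · exact absurd hb hb'
        · exact absurd hb' hb
        · exact Or.inr ⟨ha, hc, P.trans h h'⟩ }

theorem glue_iff {U : Set E} {Q : Setoid U} {P : Setoid E} {a b : E} :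
    glue U Q P a b ↔
      (∃ (ha : a ∈ U) (hb : b ∈ U), Q ⟨a, ha⟩ ⟨b, hb⟩) ∨ (a ∉ U ∧ b ∉ U ∧ P a b) := Iff.rfl

theorem res_glue (U : Set E) (Q : Setoid U) (P : Setoid E) : res U (glue U Q P) = Q := by
  ext a b
  change glue U Q P a b ↔ _
  rw [glue_iff]
  exact ⟨fun h => h.elim (fun h => h.2.2) fun h => absurd a.2 h.1, fun h => Or.inl ⟨a.2, b.2, h⟩⟩

theorem Good.glue_eq {U : Set E} {P R : Setoid E} (h : Good U P R) (Q : Setoid U) :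
    glue U Q P = glue U Q R := by
  ext a b
  rw [glue_iff, glue_iff]
  exact or_congr Iff.rfl (and_congr_right fun ha => and_congr Iff.rfl (h.2 a b ha))

theorem Good.res {T : Set E} {P Q : Setoid E} (U : Set E) (h : Good T P Q) :
    Good ((↑) ⁻¹' T : Set U) (res U P) (res U Q) :=
  ⟨fun a b => h.1 a b, fun a b => h.2 a b⟩

/-- If `Q` agrees with `P` off `T ⊆ U`, then `Q` is glued from `P` and from its restriction
to `U`. -/
theorem Good.glue_res {T U : Set E} {P Q R : Setoid E} (h : Good T P Q) (hTU : T ⊆ U)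
    (hU : Good U P R) : glue U (BipartiteGraph.res U Q) P = Q := by
  ext a b
  rw [glue_iff]
  by_cases ha : a ∈ U
  · by_cases hb : b ∈ U
    · simp [ha, hb, Setoid.comap_rel]
    · have : ¬ Q a b := fun hab =>
        hb ((hU.1 _ _ ((h.2 b a fun hb' => hb (hTU hb')).2 (Q.symm hab))).2 ha)
      simp [ha, hb, this]
  · have h1 := h.2 a b fun ha' => ha (hTU ha')
    have h2 : P a b → b ∉ U := fun hab hb => ha ((hU.1 _ _ hab).2 hb)
    simp only [ha, not_false_eq_true, true_and, IsEmpty.exists_iff, false_or, ← h1]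
    exact ⟨fun h => h.2, fun h => ⟨h2 h, h⟩⟩

theorem Good.of_res {U : Set E} {P R : Setoid E} (hU : Good U P R) {S : Set U} {Q : Setoid U}
    (h : Good S (BipartiteGraph.res U P) Q) : Good ((↑) '' S) P (glue U Q P) := by
  have hmem : ∀ a (ha : a ∈ U), a ∈ ((↑) '' S : Set E) ↔ (⟨a, ha⟩ : U) ∈ S := fun a ha => by
    simp [ha]
  have hsub : ∀ a, a ∈ ((↑) '' S : Set E) → a ∈ U := by
    rintro _ ⟨a, -, rfl⟩
    exact a.2
  refine ⟨fun a b hab => ?_, fun a b ha => ?_⟩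
  · have hU' := hU.1 a b hab
    by_cases ha : a ∈ U
    · rw [hmem a ha, hmem b (hU'.1 ha)]
      exact h.1 _ _ hab
    · exact iff_of_false (fun h => ha (hsub a h)) fun h => ha (hU'.2 (hsub b h))
  · rw [glue_iff]
    by_cases haU : a ∈ U
    · rw [hmem a haU] at ha
      constructor
      · intro hab
        have hb := (hU.1 a b hab).1 haU
        exact Or.inl ⟨haU, hb, (h.2 _ ⟨b, hb⟩ ha).1 hab⟩
      · rintro (⟨_, hb, hab⟩ | hab)
        · exact (h.2 _ ⟨b, hb⟩ ha).2 hab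
        · exact absurd haU hab.1
    · constructor
      · intro hab
        exact Or.inr ⟨haU, fun hb => haU ((hU.1 a b hab).2 hb), hab⟩
      · rintro (⟨haU', -⟩ | hab)
        · exact absurd haU' haU
        · exact hab.2.2

section Finite

variable [Finite E]

theorem isIso_res_res {T U : Set E} (h : T ⊆ U) (P Q : Setoid E) :
    IsIso (ofSetoids (res T P) (res T Q))
      (ofSetoids (res ((↑) ⁻¹' T : Set U) (res U P)) (res ((↑) ⁻¹' T : Set U) (res U Q))) :=
  ⟨Iso.ofEquiv (Γ := ofSetoids (res T P) (res T Q))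
    (Γ' := ofSetoids (res ((↑) ⁻¹' T : Set U) (res U P)) (res ((↑) ⁻¹' T : Set U) (res U Q)))
    (⟨fun a => ⟨⟨a.1, h a.2⟩, a.2⟩, fun a => ⟨a.1.1, a.2⟩, fun _ => rfl, fun _ => rfl⟩ :
      T ≃ ((↑) ⁻¹' T : Set U))
    (fun _ _ => (ofSetoids_left _ _).trans (ofSetoids_left (P := res T P) (R := res T Q) _ _).symm)
    (fun _ _ =>
      (ofSetoids_right _ _).trans (ofSetoids_right (P := res T P) (R := res T Q) _ _).symm)⟩

theorem Part.res {p : ℕ} {x : Classes p} {T U : Set E} {P Q : Setoid E} (h : Part x T P Q)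
    (hTU : T ⊆ U) : Part x ((↑) ⁻¹' T : Set U) (res U P) (res U Q) :=
  ⟨h.1.res U, h.2.trans (isIso_res_res hTU P Q)⟩

theorem Part.of_res {p : ℕ} {x : Classes p} {U : Set E} {S : Set U} {P Q : Setoid E}
    (h : Part x S (BipartiteGraph.res U P) (BipartiteGraph.res U Q))
    (hg : Good ((↑) '' S) P Q) : Part x ((↑) '' S) P Q := by
  refine ⟨hg, h.2.trans ?_⟩
  have := isIso_res_res (Subtype.coe_image_subset U S) P Q
  rw [Set.preimage_image_eq S Subtype.val_injective] at this
  exact this.symm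

/-! ### Counting the triples behind a product of two extensions -/

variable {p q : ℕ} (x : Classes p) (y : Classes q)

/-- The middle partitions and pairs of subsets with union `U` that contribute to the coefficient of
the graph given by `P` and `R` in the product of `ρ_n x` and `ρ_n y`. -/
def Contribution (P R : Setoid E) (U : Set E) : Type :=
  {z : Setoid E × Set E × Set E //
    Part x z.2.1 P z.1 ∧ Part y z.2.2 z.1 R ∧ z.2.1 ∪ z.2.2 = U}

instance (P R : Setoid E) (U : Set E) : Finite (Contribution x y P R U) :=
  inferInstanceAs (Finite {z : Setoid E × Set E × Set E //
    Part x z.2.1 P z.1 ∧ Part y z.2.2 z.1 R ∧ z.2.1 ∪ z.2.2 = U})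

variable {x y}

theorem Contribution.good {P R : Setoid E} {U : Set E} (z : Contribution x y P R U) :
    Good U P R := by
  obtain ⟨z, h1, h2, rfl⟩ := z
  exact h1.1.union h2.1

theorem Contribution.left_subset {P R : Setoid E} {U : Set E} (z : Contribution x y P R U) :
    z.1.2.1 ⊆ U := by
  obtain ⟨z, -, -, rfl⟩ := z
  exact Set.subset_union_left

theorem Contribution.right_subset {P R : Setoid E} {U : Set E} (z : Contribution x y P R U) :
    z.1.2.2 ⊆ U := by
  obtain ⟨z, -, -, rfl⟩ := z
  exact Set.subset_union_right

theorem Contribution.card_le {P R : Setoid E} {U : Set E} (z : Contribution x y P R U) :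
    Nat.card U ≤ p + q := by
  obtain ⟨z, h1, h2, rfl⟩ := z
  rw [← h1.card_eq, ← h2.card_eq]
  exact Set.ncard_union_le _ _

theorem Contribution.max_le {P R : Setoid E} {U : Set E} (z : Contribution x y P R U) :
    max p q ≤ Nat.card E :=
  _root_.max_le z.2.1.card_le z.2.2.1.card_le

/-- Both subsets lie in `U`, so `Q` must agree with `P` and `R` off `U`: restriction to `U` loses
nothing, and `glue` with `P` inverts it. -/
theorem card_contribution_res {P R : Setoid E} {U : Set E} (hU : Good U P R) :
    Nat.card (Contribution x y P R U) =
      Nat.card (Contribution x y (res U P) (res U R) Set.univ) := by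
  refine Nat.card_congr (Equiv.ofBijective
    (fun z => ⟨(res U z.1.1, (↑) ⁻¹' z.1.2.1, (↑) ⁻¹' z.1.2.2), ?_, ?_, ?_⟩) ⟨?_, ?_⟩)
  · exact z.2.1.res z.left_subset
  · exact z.2.2.1.res z.right_subset
  · change ((↑) ⁻¹' (z.1.2.1 ∪ z.1.2.2) : Set U) = Set.univ
    rw [z.2.2.2]
    exact Subtype.coe_preimage_self U
  · rintro ⟨⟨Q, T, T'⟩, h1, h2, h3⟩ ⟨⟨Q', S, S'⟩, k1, k2, k3⟩ h
    have h := congrArg Subtype.val h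
    simp only [Prod.mk.injEq] at h
    dsimp only at h1 h2 h3 k1 k2 k3
    have hT : T ⊆ U := h3 ▸ Set.subset_union_left
    have hT' : T' ⊆ U := h3 ▸ Set.subset_union_right
    have hS : S ⊆ U := k3 ▸ Set.subset_union_left
    have hS' : S' ⊆ U := k3 ▸ Set.subset_union_right
    have eS : ∀ {A B : Set E}, A ⊆ U → B ⊆ U →
        ((↑) ⁻¹' A : Set U) = ((↑) ⁻¹' B : Set U) → A = B := fun hA hB hAB => by
      rwa [Subtype.preimage_val_eq_preimage_val_iff, Set.inter_eq_right.2 hA,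
        Set.inter_eq_right.2 hB] at hAB
    have hQ : Q = Q' := by
      rw [← h1.1.glue_res hT hU, ← k1.1.glue_res hS hU, h.1]
    exact Subtype.ext (Prod.ext hQ (Prod.ext (eS hT hS h.2.1) (eS hT' hS' h.2.2)))
  · rintro ⟨⟨Q, S, S'⟩, h1, h2, h3⟩
    dsimp only at h1 h2 h3
    refine ⟨⟨(glue U Q P, (↑) '' S, (↑) '' S'), ?_, ?_, ?_⟩, ?_⟩
    · exact Part.of_res (by rwa [res_glue]) (hU.of_res h1.1)
    · refine Part.of_res (by rwa [res_glue]) ?_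
      -- The condition on `y` compares `Q` with `R`; since `P = R` off `U`, the same partition is
      -- also glued from `R`.
      rw [hU.glue_eq]
      exact (hU.symm.of_res h2.1.symm).symm
    · dsimp only
      rw [← Set.image_union, h3]
      exact Subtype.coe_image_univ U
    · refine Subtype.ext ?_
      simp only [res_glue, Set.preimage_image_eq _ Subtype.val_injective]

open Classical in
theorem coeff_rho_vec {n : ℕ} (hp : p ≤ n) (hE : Nat.card E = n) (P R : Setoid E) :
    coeff (Classes.ofSetoids hE P R) (rho hp (vec x)) =
      ∑ U : Set E, if Part x U P R then 1 else 0 := by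
  rw [rho, liftB_vec, coeff_rhoVec]
  exact Finset.sum_congr rfl fun U _ => if_congr Iff.rfl rfl rfl

/-- The matrix product counts all triples `(Q, T, T')`; they are sorted by `T ∪ T'`. -/
theorem coeff_rho_mul_rho {n : ℕ} (hp : p ≤ n) (hq : q ≤ n) (hE : Nat.card E = n)
    (P R : Setoid E) :
    coeff (Classes.ofSetoids hE P R) (rho hp (vec x) * rho hq (vec y)) =
      ∑ U : Set E, (Nat.card (Contribution x y P R U) : ℂ) := by
  classical
  simp only [coeff_mul, coeff_rho_vec, Finset.sum_mul_sum]
  rw [← Nat.cast_sum, ← Nat.card_sigma]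
  let e : (Σ U : Set E, Contribution x y P R U) ≃
      {z : Setoid E × Set E × Set E // Part x z.2.1 P z.1 ∧ Part y z.2.2 z.1 R} :=
    { toFun := fun z => ⟨z.2.1, z.2.2.1, z.2.2.2.1⟩
      invFun := fun z => ⟨_, z.1, z.2.1, z.2.2, rfl⟩
      left_inv := by
        rintro ⟨U, z, h1, h2, rfl⟩
        rfl
      right_inv := fun _ => rfl }
  rw [Nat.card_congr e, Nat.card_eq_fintype_card, Fintype.card_subtype, Finset.card_filter,
    Nat.cast_sum, Fintype.sum_prod_type]
  refine Finset.sum_congr rfl fun Q _ => ?_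
  rw [Fintype.sum_prod_type]
  refine Finset.sum_congr rfl fun T _ => Finset.sum_congr rfl fun T' _ => ?_
  by_cases h1 : Part x T P Q <;> by_cases h2 : Part y T' Q R <;> simp [h1, h2]

end Finite

/-! ### The brackets -/

variable {p q : ℕ} (x : Classes p) (y : Classes q)

theorem bracket_of_lt {n : ℕ} (h : n < max p q) : bracket x y n = 0 := by
  rw [bracket, dif_neg (not_le.2 h)]

theorem bracket_of_le {n : ℕ} (h : max p q ≤ n) :
    bracket x y n =
      rho ((le_max_left p q).trans h) (vec x) * rho ((le_max_right p q).trans h) (vec y) -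
        ∑ k : Fin n, rho k.2.le (bracket x y (k : ℕ)) := by
  rw [bracket, dif_pos h]
  congr 1
  refine Finset.sum_congr rfl fun k _ => ?_
  split_ifs with hk
  · rfl
  · rw [bracket_of_lt x y (not_le.1 hk), map_zero]

/-- Strong induction: the terms of the product with a proper union `U` are those subtracted by the
recursion for `k = |U|`, so only the triples covering `E` survive. -/
theorem coeff_bracket (n : ℕ) {E : Type} [Finite E] (hE : Nat.card E = n) (P R : Setoid E) :
    coeff (Classes.ofSetoids hE P R) (bracket x y n) =
      Nat.card (Contribution x y P R Set.univ) := by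
  classical
  induction n using Nat.strong_induction_on generalizing E with | _ n ih =>
  by_cases h : max p q ≤ n
  · have key : ∀ k : Fin n, coeff (Classes.ofSetoids hE P R) (rho k.2.le (bracket x y (k : ℕ))) =
        ∑ U : Set E, if Nat.card U = k then (Nat.card (Contribution x y P R U) : ℂ) else 0 := by
      intro k
      rw [coeff_rho]
      refine Finset.sum_congr rfl fun U _ => ?_
      split_ifs with h1 h2 h2
      · rw [ih k k.2, ← card_contribution_res h1.1]
      · exact absurd h1.2 h2
      -- A set `U` of the right size that `coeff_rho` skips is not good, hence is not the union of
      -- any triple.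
      · have : IsEmpty (Contribution x y P R U) := ⟨fun z => h1 ⟨z.good, h2⟩⟩
        simp
      · rfl
    rw [bracket_of_le x y h, map_sub, coeff_rho_mul_rho, map_sum,
      Finset.sum_congr rfl fun k _ => key k, Finset.sum_comm, ← Finset.sum_sub_distrib,
      Finset.sum_eq_single Set.univ]
    · rw [Finset.sum_eq_zero, sub_zero]
      intro k _
      refine if_neg fun hk => k.2.ne ?_
      rw [← hk, Nat.card_univ, hE]
    · intro U _ hU
      have hlt : Nat.card U < n := by
        rw [← hE]
        exact Set.ncard_lt_card hU
      rw [Finset.sum_eq_single ⟨Nat.card U, hlt⟩, if_pos rfl, sub_self]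
      · intro k _ hk
        exact if_neg fun h => hk (Fin.ext h.symm)
      · exact fun h => absurd (Finset.mem_univ _) h
    · exact fun h => absurd (Finset.mem_univ _) h
  · have : IsEmpty (Contribution x y P R Set.univ) := ⟨fun z => h (hE ▸ z.max_le)⟩
    rw [bracket_of_lt x y (not_le.1 h)]
    simp

theorem bracket_eq_zero {n : ℕ} (h : p + q < n) : bracket x y n = 0 := by
  refine B_ext_ofSetoids fun E _ hE P R => ?_
  have : IsEmpty (Contribution x y P R Set.univ) :=
    ⟨fun z => by
      have := z.card_le
      rw [Nat.card_univ, hE] at this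
      omega⟩
  rw [coeff_bracket]
  simp

theorem isIso_res_univ {E : Type} [Finite E] (P R : Setoid E) :
    IsIso (ofSetoids (res Set.univ P) (res Set.univ R)) (ofSetoids P R) :=
  ⟨Iso.ofEquiv (Γ := ofSetoids (res Set.univ P) (res Set.univ R)) (Γ' := ofSetoids P R)
    (Equiv.Set.univ E)
    (fun _ _ => (ofSetoids_left _ _).trans
      (ofSetoids_left (P := res Set.univ P) (R := res Set.univ R) _ _).symm)
    (fun _ _ => (ofSetoids_right _ _).trans
      (ofSetoids_right (P := res Set.univ P) (R := res Set.univ R) _ _).symm)⟩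

theorem rho_self {n : ℕ} (h : n ≤ n) (b : B n) : rho h b = b := by
  classical
  refine B_ext_ofSetoids fun E _ hE P R => ?_
  rw [coeff_rho, Finset.sum_eq_single Set.univ]
  · have hu : Good Set.univ P R ∧ Nat.card (Set.univ : Set E) = n :=
      ⟨good_univ P R, by rw [Nat.card_univ, hE]⟩
    rw [dif_pos hu]
    congr 2
    exact Classes.mk_eq_mk.2 (isIso_res_univ P R)
  · intro U _ hU
    refine dif_neg fun h => (Set.ncard_lt_card hU).ne ?_
    rw [hE]
    exact h.2
  · exact fun h => absurd (Finset.mem_univ _) h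

/-! ### The embedding of `BInf` into sequences -/

/-- The basis vector of `B_∞` given by a graph. -/
def vecInf (x : Σ n : ℕ+, Classes n) : BInf :=
  (Finsupp.single x 1 : (Σ n : ℕ+, Classes n) →₀ ℂ)

theorem liftInf_vecInf {M : Type 1} [AddCommGroup M] [Module ℂ M]
    (f : (Σ n : ℕ+, Classes n) → M) (x : Σ n : ℕ+, Classes n) : liftInf f (vecInf x) = f x :=
  (Finsupp.linearCombination_single ℂ 1 x).trans (one_smul ℂ _)

theorem incl_vec (n : ℕ+) (x : Classes n) : incl n (vec x) = vecInf ⟨n, x⟩ := liftB_vec _ _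

theorem BInf_induction {p : BInf → Prop} (zero : p 0) (add : ∀ a b, p a → p b → p (a + b))
    (smul : ∀ (z : ℂ) x, p (z • vecInf x)) (b : BInf) : p b := by
  refine Finsupp.induction_linear (motive := p) b zero add fun x z => ?_
  have h : (Finsupp.single x z : (Σ n : ℕ+, Classes n) →₀ ℂ) = z • Finsupp.single x 1 := by simp
  rw [h]
  exact smul z x

theorem vecInf_mul_vecInf (x y : Σ n : ℕ+, Classes n) : vecInf x * vecInf y = circVec x y := by
  change circ (vecInf x) (vecInf y) = _
  rw [circ, liftInf_vecInf, liftInf_vecInf]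

/-- The linear map `ρ_↑` from `B_∞` to `B^as`. -/
def rhoUp : BInf →ₗ[ℂ] BAs := liftInf fun x => asSeq (vec x.2)

theorem rhoUp_incl (n : ℕ+) (b : B n) : rhoUp (incl n b) = asSeq b := by
  funext i
  induction b using B_induction with
  | zero => simp [asSeq]
  | add a b ha hb =>
    rw [map_add, map_add, Pi.add_apply, ha, hb]
    unfold asSeq
    split_ifs <;> simp
  | smul z x =>
    rw [map_smul, map_smul, Pi.smul_apply, incl_vec, rhoUp, liftInf_vecInf]
    unfold asSeq
    split_ifs <;> simp

/-- The recursion for the bracket solved for the product, the top term being `rho_self`. For `i`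
below one of the degrees both sides vanish. -/
theorem sum_rho_bracket {p q : ℕ} (x : Classes p) (y : Classes q) (i : ℕ) :
    ∑ k ∈ Finset.range (i + 1), (if h : k ≤ i then rho h (bracket x y k) else 0) =
      (if h : p ≤ i then rho h (vec x) else 0) * (if h : q ≤ i then rho h (vec y) else 0) := by
  by_cases h : max p q ≤ i
  · rw [dif_pos ((le_max_left p q).trans h), dif_pos ((le_max_right p q).trans h),
      Finset.sum_range_succ, dif_pos le_rfl, rho_self, bracket_of_le x y h, Finset.sum_range]
    rw [Finset.sum_congr rfl fun (k : Fin i) _ => dif_pos k.2.le, add_sub_cancel]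
  · rw [Finset.sum_eq_zero]
    · rw [max_le_iff, not_and_or] at h
      rcases h with h | h
      · rw [dif_neg h, zero_mul]
      · rw [dif_neg h, mul_zero]
    · intro k hk
      have hk : k ≤ i := Nat.lt_succ_iff.1 (Finset.mem_range.1 hk)
      rw [dif_pos hk, bracket_of_lt x y (hk.trans_lt (not_le.1 h)), map_zero]

theorem rhoUp_circVec (x y : Σ n : ℕ+, Classes n) :
    rhoUp (circVec x y) = asSeq (vec x.2) * asSeq (vec y.2) := by
  classical
  -- Finite support makes the `finsum` in `circVec` a genuine sum, so that linear maps pass through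
  -- it.
  have hfin : (Function.support fun n : ℕ+ => incl n (bracket x.2 y.2 n)).Finite := by
    refine (Set.finite_Iic (x.1 + y.1)).subset fun n hn => ?_
    by_contra hlt
    refine hn ?_
    have : (x.1 : ℕ) + y.1 < n := by
      rw [← PNat.add_coe, PNat.coe_lt_coe]
      exact not_le.1 hlt
    change incl n _ = 0
    rw [bracket_eq_zero _ _ this, map_zero]
  funext i
  have h1 : rhoUp (circVec x y) i = ∑ᶠ n : ℕ+, rhoUp (incl n (bracket x.2 y.2 n)) i :=
    ((Pi.evalAddMonoidHom (fun n : ℕ+ => B n) i).comp rhoUp.toAddMonoidHom).map_finsum hfin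
  let f : ℕ → B i := fun k => if h : k ≤ i then rho h (bracket x.2 y.2 k) else 0
  have h2 : ∑ᶠ n : ℕ+, rhoUp (incl n (bracket x.2 y.2 n)) i = ∑ᶠ k : ℕ, f (k + 1) := by
    rw [← finsum_comp_equiv Equiv.pnatEquivNat.symm]
    refine finsum_congr fun k => ?_
    rw [rhoUp_incl]
    rfl
  have h3 : ∑ᶠ k : ℕ, f (k + 1) = ∑ k ∈ Finset.range i, f (k + 1) := by
    refine finsum_eq_sum_of_support_subset _ fun k hk => ?_
    by_contra hlt
    refine hk (dif_neg fun h => hlt ?_)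
    simpa using h
  -- The sum over `ℕ+` omits degree `0`; the bracket vanishes there since both degrees are positive,
  -- so the range can start at `0`.
  have h0 : f 0 = 0 := by
    have : 0 < max (x.1 : ℕ) y.1 := lt_max_of_lt_left x.1.pos
    simp only [f]
    rw [dif_pos (Nat.zero_le _), bracket_of_lt _ _ this, map_zero]
  rw [h1, h2, h3, Pi.mul_apply, ← add_zero (∑ k ∈ Finset.range (i : ℕ), f (k + 1)), ← h0,
    ← Finset.sum_range_succ']
  exact sum_rho_bracket x.2 y.2 i

theorem rhoUp_mul (a b : BInf) : rhoUp (a * b) = rhoUp a * rhoUp b := by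
  induction a using BInf_induction with
  | zero => simp
  | add a a' h h' => simp only [add_mul, map_add, h, h']
  | smul z x =>
    induction b using BInf_induction with
    | zero => simp
    | add b b' h h' => simp only [mul_add, map_add, h, h']
    | smul w y =>
      rw [smul_mul_smul_comm, map_smul, map_smul, map_smul, smul_mul_smul_comm,
        vecInf_mul_vecInf, rhoUp_circVec, rhoUp, liftInf_vecInf, liftInf_vecInf]

open Classical in
-- Triangularity: a sequence vanishes before its own degree, and its first entry is the vector
-- itself.
theorem coeff_asSeq_vec {i : ℕ+} (c : Classes i) (x : Σ n : ℕ+, Classes n) (h : i ≤ x.1) :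
    coeff c (asSeq (vec x.2) i) = if x = ⟨i, c⟩ then 1 else 0 := by
  obtain ⟨n, x⟩ := x
  rcases h.lt_or_eq with h | h
  · have hne : ¬ (⟨n, x⟩ : Σ n : ℕ+, Classes n) = ⟨i, c⟩ := fun hx =>
      h.ne' (congrArg Sigma.fst hx)
    rw [if_neg hne, asSeq, dif_neg (not_le.2 (PNat.coe_lt_coe _ _ |>.2 h)), map_zero]
  · dsimp only at h
    subst h
    rw [asSeq, dif_pos le_rfl, rho_self, coeff_vec]
    simp [eq_comm]

theorem rhoUp_injective : Function.Injective rhoUp := by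
  classical
  rw [injective_iff_map_eq_zero]
  intro b hb
  let f : (Σ n : ℕ+, Classes n) →₀ ℂ := b
  have hf : ∀ i : ℕ+, ∀ c : Classes i, f ⟨i, c⟩ = 0 := by
    intro i
    -- At entry `i`, lower degrees contribute nothing by induction and higher ones by triangularity,
    -- so the vanishing entry is the component of degree `i`.
    induction i using PNat.strongInductionOn with | _ i ih =>
    intro c
    have h : coeff c ((∑ x ∈ f.support, f x • asSeq (vec x.2)) i) = 0 := by
      have hz : coeff c (rhoUp b i) = 0 := by
        rw [hb]
        exact map_zero _
      exact hz
    rw [Finset.sum_apply, map_sum, Finset.sum_congr rfl (g := fun x => if x = ⟨i, c⟩ then f x else 0),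
      Finset.sum_ite_eq'] at h
    · split_ifs at h with hs
      · exact h
      · exact Finsupp.notMem_support_iff.1 hs
    · rintro ⟨n, x⟩ -
      rw [Pi.smul_apply, map_smul]
      rcases lt_or_ge n i with hn | hn
      · have hne : ¬ (⟨n, x⟩ : Σ n : ℕ+, Classes n) = ⟨i, c⟩ := fun hx =>
          hn.ne (congrArg Sigma.fst hx)
        rw [ih n hn x, zero_smul, if_neg hne]
      · rw [coeff_asSeq_vec c ⟨n, x⟩ hn, smul_eq_mul, mul_ite, mul_one, mul_zero]
  exact (Finsupp.ext fun x => hf x.1 x.2 : f = 0)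

theorem BAs_mul_assoc (a b c : BAs) : a * b * c = a * (b * c) :=
  funext fun i => B_mul_assoc (a i) (b i) (c i)

end BipartiteGraph

end

theorem theorem3p3 :
    -- the sums that define the product of `B_∞` are finite
    (∀ (p q : ℕ+) (x : BipartiteGraph.Classes p) (y : BipartiteGraph.Classes q) (n : ℕ),
      (p : ℕ) + q < n → BipartiteGraph.bracket x y n = 0) ∧
    -- the products of `B_∞` and `B^as` are associative
    (∀ a b c : BipartiteGraph.BInf, a * b * c = a * (b * c)) ∧
    (∀ a b c : BipartiteGraph.BAs, a * b * c = a * (b * c)) ∧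
    -- the correspondence extends to an injective homomorphism of algebras
    ∃ φ : BipartiteGraph.BInf →ₙₐ[ℂ] BipartiteGraph.BAs,
      (∀ (n : ℕ+) (b : BipartiteGraph.B n),
        φ (BipartiteGraph.incl n b) = BipartiteGraph.asSeq b) ∧
      Function.Injective φ := by
  refine ⟨fun p q x y n h => BipartiteGraph.bracket_eq_zero x y h, fun a b c => ?_,
    BipartiteGraph.BAs_mul_assoc,
    { BipartiteGraph.rhoUp with
      map_zero' := map_zero BipartiteGraph.rhoUp
      map_mul' := BipartiteGraph.rhoUp_mul },
    BipartiteGraph.rhoUp_incl, BipartiteGraph.rhoUp_injective⟩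
  -- Associativity of `∘` is checked after embedding into the associative algebra of sequences.
  refine BipartiteGraph.rhoUp_injective ?_
  simp only [BipartiteGraph.rhoUp_mul, BipartiteGraph.BAs_mul_assoc]
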